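/- All manifolds are smooth, Hausdorff, without boundary and of some fixed finite dimension; all vector bundles are smooth, real and of some fixed finite rank. Let $\mathcal G=(G_1\rightrightarrows G_0)$ be an orbifold groupoid, i.e. a Lie groupoid whose source and target maps $s,t:G_1\to G_0$ are local diffeomorphisms and for which $(s,t):G_1\to G_0\times G_0$ is proper, and suppose that $\mathcal G$ represents an orbifold: there is a homeomorphism from the orbit space $|\mathcal G|$ onto a paracompact Hausdorff space $X$. Let $E\to\mathcal G$ be a vector $\mathcal G$-bundle, i.e. a vector bundle $E\to G_0$ with a smooth fibrewise linear action $E_{s(\gamma)}\to E_{t(\gamma)}$ of the arrows $\gamma$ that respects units and composition. An arrow $\gamma$ acts on tangent vectors by the differential of the germ of local diffeomorphism $t\circ s^{-1}$ that it induces. Let $C^\infty(\mathcal G)$, $\Gamma(\mathcal G,E)$, $\Omega^1(\mathcal G,E)$ and $\Omega^1(\mathcal G,\operatorname{End}E)$ be the spaces of smooth functions on $G_0$, smooth sections of $E$, smooth sections of $T^*G_0\otimes E$ and smooth sections of $T^*G_0\otimes\operatorname{End}E$ that are invariant under all arrows. A *connection* on $E$ is an $\mathbb R$-linear map $\nabla:\Gamma(\mathcal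 G,E)\to\Omega^1(\mathcal G,E)$ with $\nabla(\varphi\xi)=d\varphi\otimes\xi+\varphi\nabla\xi$ for all $\varphi\in C^\infty(\mathcal G)$, $\xi\in\Gamma(\mathcal G,E)$. An *invariant connection* on $E$ is a connection $D:\Gamma(G_0,E)\to\Gamma(G_0,T^*G_0\otimes E)$ on the vector bundle $E\to G_0$ that is preserved by the arrows: if $\gamma$ is an arrow and $\xi,\eta\in\Gamma(G_0,E)$ satisfy $\eta(t(\delta))=\delta\cdot\xi(s(\delta))$ for all arrows $\delta$ near $\gamma$, then $(D\eta)(t(\gamma))=\gamma\cdot(D\xi)(s(\gamma))$. Then: 1. There exists a connection on $E$. 2. The connections on $E$ form a nonempty affine space modelled on $\operatorname{Hom}_{C^\infty(\mathcal G)}(\Gamma(\mathcal G,E),\Omega^1(\mathcal G,E))$, where $L$ acts by $\nabla\mapsto\nabla+L$. 3. The invariant connections on $E$ form a nonempty affine space modelled on $\Omega^1(\mathcal G,\operatorname{End}E)$, where $A$ acts by $(D+A)\xi=D\xi+A\xi$. 4. Every invariant connection on $E$ restricts to a connection on $E$. -/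

import Mathlib

open Bundle Filter
open scoped Manifold ContDiff Topology Bundle

noncomputable section

section Groupoids

/-- A Lie groupoid with object manifold `G₀` (modelled on `B₀`) and arrow manifold `G₁`
(modelled on `B₁`). An arrow `g` goes from `src g` to `tgt g`, and `mul g h` is the composite
`g ∘ h`, which is meaningful when `src g = tgt h`: every axiom about `mul` is restricted to
composable pairs, and the values of `mul` on other pairs play no role. In particular smoothness of
the multiplication is smoothness on the fibred product `{(g, h) | src g = tgt h}`, an embedded
submanifold of `G₁ × G₁`. -/
structure LieGroupoid (B₀ B₁ : Type*) [NormedAddCommGroup B₀] [NormedSpace ℝ B₀]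
    [NormedAddCommGroup B₁] [NormedSpace ℝ B₁]
    (G₀ G₁ : Type*) [TopologicalSpace G₀] [ChartedSpace B₀ G₀]
    [TopologicalSpace G₁] [ChartedSpace B₁ G₁] where
  src : C^∞⟮𝓘(ℝ, B₁), G₁; 𝓘(ℝ, B₀), G₀⟯
  tgt : C^∞⟮𝓘(ℝ, B₁), G₁; 𝓘(ℝ, B₀), G₀⟯
  unit : C^∞⟮𝓘(ℝ, B₀), G₀; 𝓘(ℝ, B₁), G₁⟯
  inv : C^∞⟮𝓘(ℝ, B₁), G₁; 𝓘(ℝ, B₁), G₁⟯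
  mul : G₁ → G₁ → G₁
  src_unit : ∀ x, src (unit x) = x
  tgt_unit : ∀ x, tgt (unit x) = x
  src_inv : ∀ g, src (inv g) = tgt g
  tgt_inv : ∀ g, tgt (inv g) = src g
  src_mul : ∀ g h, src g = tgt h → src (mul g h) = src h
  tgt_mul : ∀ g h, src g = tgt h → tgt (mul g h) = tgt g
  mul_assoc : ∀ g h k, src g = tgt h → src h = tgt k → mul (mul g h) k = mul g (mul h k)
  unit_mul : ∀ g, mul (unit (tgt g)) g = g
  mul_unit : ∀ g, mul g (unit (src g)) = g
  inv_mul : ∀ g, mul (inv g) g = unit (src g)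
  mul_inv : ∀ g, mul g (inv g) = unit (tgt g)
  contMDiffOn_mul : ContMDiffOn (𝓘(ℝ, B₁).prod 𝓘(ℝ, B₁)) 𝓘(ℝ, B₁) ∞
    (fun p : G₁ × G₁ => mul p.1 p.2) {p | src p.1 = tgt p.2}
  isSubmersion_src : ∀ g, Manifold.IsSubmersionAt 𝓘(ℝ, B₁) 𝓘(ℝ, B₀) ∞ src g

namespace LieGroupoid

variable {B₀ B₁ : Type*} [NormedAddCommGroup B₀] [NormedSpace ℝ B₀]
  [NormedAddCommGroup B₁] [NormedSpace ℝ B₁]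
  {G₀ G₁ : Type*} [TopologicalSpace G₀] [ChartedSpace B₀ G₀]
  [TopologicalSpace G₁] [ChartedSpace B₁ G₁]
  (G : LieGroupoid B₀ B₁ G₀ G₁)

/-- The set of arrows from `x` to `y`. -/
def Hom (x y : G₀) : Type _ := {g : G₁ // G.src g = x ∧ G.tgt g = y}

/-- An element of the arrow space, as an arrow from its source to its target. -/
def arrow (g : G₁) : G.Hom (G.src g) (G.tgt g) := ⟨g, rfl, rfl⟩

/-- The identity arrow at `x`. -/
def id (x : G₀) : G.Hom x x := ⟨G.unit x, G.src_unit x, G.tgt_unit x⟩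

/-- The composite `g ∘ h` of `h : x ⟶ y` and `g : y ⟶ z`. -/
def comp {x y z : G₀} (g : G.Hom y z) (h : G.Hom x y) : G.Hom x z :=
  ⟨G.mul g.1 h.1,
    (G.src_mul _ _ (g.2.1.trans h.2.2.symm)).trans h.2.1,
    (G.tgt_mul _ _ (g.2.1.trans h.2.2.symm)).trans g.2.2⟩

/-- Two objects are in the same orbit when some arrow connects them. -/
def orbitSetoid : Setoid G₀ where
  r x y := Nonempty (G.Hom x y)
  iseqv :=
    { refl := fun x => ⟨G.id x⟩
      symm := fun ⟨g⟩ => ⟨⟨G.inv g.1, (G.src_inv _).trans g.2.2, (G.tgt_inv _).trans g.2.1⟩⟩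
      trans := fun ⟨g⟩ ⟨h⟩ => ⟨G.comp h g⟩ }

/-- The orbit space `|G|` of the groupoid, with the quotient topology. -/
def OrbitSpace : Type _ := Quotient G.orbitSetoid

instance : TopologicalSpace G.OrbitSpace :=
  inferInstanceAs (TopologicalSpace (Quotient G.orbitSetoid))

/-- Source and target are local diffeomorphisms. -/
def IsEtale : Prop :=
  IsLocalDiffeomorph 𝓘(ℝ, B₁) 𝓘(ℝ, B₀) ∞ G.src ∧ IsLocalDiffeomorph 𝓘(ℝ, B₁) 𝓘(ℝ, B₀) ∞ G.tgt

/-- The map `(s, t) : G₁ → G₀ × G₀` is proper. -/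
def IsProper : Prop := IsProperMap fun g : G₁ => (G.src g, G.tgt g)

/-- An orbifold groupoid is a proper étale Lie groupoid. -/
structure IsOrbifoldGroupoid : Prop where
  isEtale : G.IsEtale
  isProper : G.IsProper

/-- The algebra `C^∞(G)` of smooth functions on `G₀` that are constant along arrows. -/
def smoothFunctions : Subalgebra ℝ C^∞⟮𝓘(ℝ, B₀), G₀; ℝ⟯ where
  carrier := {f | ∀ g : G₁, f (G.tgt g) = f (G.src g)}
  mul_mem' hf hf' g := by simp [hf g, hf' g]
  add_mem' hf hf' g := by simp [hf g, hf' g]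
  algebraMap_mem' r g := rfl

end LieGroupoid

end Groupoids

section Bundles

variable {B₀ B₁ : Type*} [NormedAddCommGroup B₀] [NormedSpace ℝ B₀]
  [NormedAddCommGroup B₁] [NormedSpace ℝ B₁]
  {G₀ G₁ : Type*} [TopologicalSpace G₀] [ChartedSpace B₀ G₀]
  [TopologicalSpace G₁] [ChartedSpace B₁ G₁]

/-- The structure of a vector `G`-bundle on a smooth real vector bundle `V → G₀` with model
fibre `F`: a fibrewise linear action of the arrows on the fibres, such that the action map
`G₁ ×_{s,π} V → V` is smooth. The fibred product is the total space of the pullback `s^* V`. -/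
structure VectorGBundle (G : LieGroupoid B₀ B₁ G₀ G₁)
    (F : Type*) [NormedAddCommGroup F] [NormedSpace ℝ F]
    (V : G₀ → Type*) [TopologicalSpace (TotalSpace F V)]
    [∀ x, AddCommGroup (V x)] [∀ x, Module ℝ (V x)] [∀ x, TopologicalSpace (V x)]
    [FiberBundle F V] [VectorBundle ℝ F V] [ContMDiffVectorBundle ∞ F V 𝓘(ℝ, B₀)] where
  act : ∀ {x y : G₀}, G.Hom x y → V x →ₗ[ℝ] V y
  act_id : ∀ (x : G₀) (v : V x), act (G.id x) v = v
  act_comp : ∀ {x y z : G₀} (g : G.Hom y z) (h : G.Hom x y) (v : V x),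
    act (G.comp g h) v = act g (act h v)
  contMDiff_act : ContMDiff (𝓘(ℝ, B₁).prod 𝓘(ℝ, F)) (𝓘(ℝ, B₀).prod 𝓘(ℝ, F)) ∞
    (fun p : TotalSpace F (G.src *ᵖ V) =>
      (⟨G.tgt p.proj, act (G.arrow p.proj) p.snd⟩ : TotalSpace F V))

/-- Multiplication of smooth sections of a vector bundle by smooth functions. -/
instance sectionModule {I : ModelWithCorners ℝ B₀ B₀}
    {F : Type*} [NormedAddCommGroup F] [NormedSpace ℝ F]
    {V : G₀ → Type*} [TopologicalSpace (TotalSpace F V)]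
    [∀ x, AddCommGroup (V x)] [∀ x, Module ℝ (V x)] [∀ x, TopologicalSpace (V x)]
    [FiberBundle F V] [VectorBundle ℝ F V] :
    Module C^∞⟮I, G₀; ℝ⟯ Cₛ^∞⟮I; F, V⟯ where
  smul f s := ⟨fun x => f x • s x, f.contMDiff.smul_section s.contMDiff⟩
  one_smul s := by ext x; exact one_smul ℝ (s x)
  mul_smul f f' s := by ext x; exact mul_smul (f x) (f' x) (s x)
  smul_zero f := by ext x; exact smul_zero (f x)
  smul_add f s s' := by ext x; exact smul_add (f x) (s x) (s' x)
  add_smul f f' s := by ext x; exact add_smul (f x) (f' x) (s x)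
  zero_smul s := by ext x; exact zero_smul ℝ (s x)

namespace VectorGBundle

variable {G : LieGroupoid B₀ B₁ G₀ G₁} [IsManifold 𝓘(ℝ, B₀) ∞ G₀]
  {F : Type*} [NormedAddCommGroup F] [NormedSpace ℝ F]
  {V : G₀ → Type*} [TopologicalSpace (TotalSpace F V)]
  [∀ x, AddCommGroup (V x)] [∀ x, Module ℝ (V x)] [∀ x, TopologicalSpace (V x)]
  [∀ x, IsTopologicalAddGroup (V x)] [∀ x, ContinuousSMul ℝ (V x)]
  [FiberBundle F V] [VectorBundle ℝ F V] [ContMDiffVectorBundle ∞ F V 𝓘(ℝ, B₀)]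
  (E : VectorGBundle G F V)

/-- The smooth sections of `T^*G₀ ⊗ V = Hom(TG₀, V)`, i.e. the `V`-valued `1`-forms on `G₀`. -/
abbrev BaseForms (_E : VectorGBundle G F V) : Type _ :=
  Cₛ^∞⟮𝓘(ℝ, B₀); B₀ →L[ℝ] F, fun x : G₀ => TangentSpace 𝓘(ℝ, B₀) x →L[ℝ] V x⟯

/-- The smooth sections of `T^*G₀ ⊗ End V = Hom(TG₀, End V)`, i.e. the `End V`-valued `1`-forms
on `G₀`. -/
abbrev BaseEndForms (_E : VectorGBundle G F V) : Type _ :=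
  Cₛ^∞⟮𝓘(ℝ, B₀); B₀ →L[ℝ] F →L[ℝ] F,
    fun x : G₀ => TangentSpace 𝓘(ℝ, B₀) x →L[ℝ] V x →L[ℝ] V x⟯

set_option synthInstance.maxHeartbeats 200000 in
instance (E : VectorGBundle G F V) : AddCommGroup E.BaseEndForms := inferInstance

set_option synthInstance.maxHeartbeats 200000 in
instance (E : VectorGBundle G F V) : Module ℝ E.BaseEndForms := inferInstance

/-- The differential of the source map at an arrow. -/
abbrev dsrc (_E : VectorGBundle G F V) (g : G₁) :
    TangentSpace 𝓘(ℝ, B₁) g →L[ℝ] TangentSpace 𝓘(ℝ, B₀) (G.src g) :=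
  mfderiv 𝓘(ℝ, B₁) 𝓘(ℝ, B₀) G.src g

/-- The differential of the target map at an arrow. For an étale groupoid, `g` acts on tangent
vectors by `dt_g ∘ (ds_g)⁻¹`, so that the vectors `ds_g w` and `dt_g w`, for `w` tangent to `G₁` at
`g`, are precisely the pairs formed by a tangent vector at `src g` and its image under `g`. -/
abbrev dtgt (_E : VectorGBundle G F V) (g : G₁) :
    TangentSpace 𝓘(ℝ, B₁) g →L[ℝ] TangentSpace 𝓘(ℝ, B₀) (G.tgt g) :=
  mfderiv 𝓘(ℝ, B₁) 𝓘(ℝ, B₀) G.tgt g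

/-- The sections `Γ(G, E)` of a vector `G`-bundle: the smooth sections `ξ` of the underlying vector
bundle with `ξ (tgt g) = g · ξ (src g)` for all arrows `g`. -/
def sections : Submodule ℝ Cₛ^∞⟮𝓘(ℝ, B₀); F, V⟯ where
  carrier := {ξ | ∀ g : G₁, ξ (G.tgt g) = E.act (G.arrow g) (ξ (G.src g))}
  add_mem' h h' g := by simp [h g, h' g]
  zero_mem' g := by simp
  smul_mem' c ξ h g := by simp [h g]

/-- The space `Ω¹(G, E)` of `E`-valued `1`-forms on an étale groupoid `G`: the `1`-forms `α` on `G₀`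
with `α (g · v) = g · α (v)` for all arrows `g` and all tangent vectors `v` at the source. -/
def forms : Submodule ℝ E.BaseForms where
  carrier := {α | ∀ (g : G₁) (w : TangentSpace 𝓘(ℝ, B₁) g),
    α (G.tgt g) (E.dtgt g w) = E.act (G.arrow g) (α (G.src g) (E.dsrc g w))}
  add_mem' h h' g w := by simp [h g, h' g]
  zero_mem' g := by simp
  smul_mem' c α h g w := by simp [h g]

/-- The space `Ω¹(G, End E)` of `End(E)`-valued `1`-forms on an étale groupoid `G`, where an arrow
`g` acts on `End(E)` by conjugation. -/
def endForms : Submodule ℝ E.BaseEndForms where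
  carrier := {A | ∀ (g : G₁) (w : TangentSpace 𝓘(ℝ, B₁) g) (v : V (G.src g)),
    A (G.tgt g) (E.dtgt g w) (E.act (G.arrow g) v) =
      E.act (G.arrow g) (A (G.src g) (E.dsrc g w) v)}
  add_mem' h h' g w v := by simp [h g, h' g]
  zero_mem' g := by simp
  smul_mem' c A h g w v := by simp [h g]

/-- `Γ(G, E)` is a module over `C^∞(G)`, by pointwise multiplication. -/
instance : Module G.smoothFunctions E.sections where
  smul f ξ := ⟨f.1 • ξ.1, fun g => by
    change f.1 (G.tgt g) • ξ.1 (G.tgt g) = E.act _ (f.1 (G.src g) • ξ.1 (G.src g))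
    rw [f.2 g, ξ.2 g, map_smul]⟩
  one_smul s := Subtype.ext (one_smul _ s.1)
  mul_smul f f' s := Subtype.ext (mul_smul f.1 f'.1 s.1)
  smul_zero f := Subtype.ext (smul_zero f.1)
  smul_add f s s' := Subtype.ext (smul_add f.1 s.1 s'.1)
  add_smul f f' s := Subtype.ext (add_smul f.1 f'.1 s.1)
  zero_smul s := Subtype.ext (zero_smul _ s.1)

/-- `Ω¹(G, E)` is a module over `C^∞(G)`, by pointwise multiplication. -/
instance : Module G.smoothFunctions E.forms where
  smul f α := ⟨f.1 • α.1, fun g w => by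
    change f.1 (G.tgt g) • α.1 (G.tgt g) (E.dtgt g w) =
      E.act _ (f.1 (G.src g) • α.1 (G.src g) (E.dsrc g w))
    rw [f.2 g, α.2 g w, map_smul]⟩
  one_smul s := Subtype.ext (one_smul _ s.1)
  mul_smul f f' s := Subtype.ext (mul_smul f.1 f'.1 s.1)
  smul_zero f := Subtype.ext (smul_zero f.1)
  smul_add f s s' := Subtype.ext (smul_add f.1 s.1 s'.1)
  add_smul f f' s := Subtype.ext (add_smul f.1 f'.1 s.1)
  zero_smul s := Subtype.ext (zero_smul C^∞⟮𝓘(ℝ, B₀), G₀; ℝ⟯ s.1)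

instance : SMul G.smoothFunctions E.sections :=
  (inferInstance : Module G.smoothFunctions E.sections).toSMul

instance : SMul G.smoothFunctions E.forms :=
  (inferInstance : Module G.smoothFunctions E.forms).toSMul

/-- A connection on the vector `G`-bundle `E`: an `ℝ`-linear map `∇ : Γ(G, E) → Ω¹(G, E)` with
`∇ (φ ξ) = dφ ⊗ ξ + φ ∇ ξ` for all `φ ∈ C^∞(G)` and `ξ ∈ Γ(G, E)`. -/
structure Connection where
  toFun : E.sections →ₗ[ℝ] E.forms
  leibniz : ∀ (φ : G.smoothFunctions) (ξ : E.sections) (x : G₀) (v : TangentSpace 𝓘(ℝ, B₀) x),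
    (toFun (φ • ξ)).1 x v =
      mvfderiv 𝓘(ℝ, B₀) φ.1 x v • ξ.1 x + φ.1 x • (toFun ξ).1 x v

/-- An invariant connection on the vector `G`-bundle `E`: a connection `D` on the underlying vector
bundle over `G₀` that is preserved by the local diffeomorphisms which the arrows induce.
That is, `D` is defined on all smooth sections over `G₀`, satisfies the Leibniz rule for all smooth
functions on `G₀`, and whenever the germ of `η` at `tgt g` is the image under the arrow `g` of the
germ of `ξ` at `src g`, then `D η (tgt g)` is the image under `g` of `D ξ (src g)`. -/
structure InvariantConnection where
  toFun : Cₛ^∞⟮𝓘(ℝ, B₀); F, V⟯ →ₗ[ℝ] E.BaseForms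
  leibniz : ∀ (φ : C^∞⟮𝓘(ℝ, B₀), G₀; ℝ⟯) (ξ : Cₛ^∞⟮𝓘(ℝ, B₀); F, V⟯) (x : G₀)
    (v : TangentSpace 𝓘(ℝ, B₀) x),
    toFun (φ • ξ) x v = mvfderiv 𝓘(ℝ, B₀) φ x v • ξ x + φ x • toFun ξ x v
  invariant : ∀ (g : G₁) (ξ η : Cₛ^∞⟮𝓘(ℝ, B₀); F, V⟯),
    (∀ᶠ h in 𝓝 g, η (G.tgt h) = E.act (G.arrow h) (ξ (G.src h))) →
    ∀ w : TangentSpace 𝓘(ℝ, B₁) g,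
      toFun η (G.tgt g) (E.dtgt g w) = E.act (G.arrow g) (toFun ξ (G.src g) (E.dsrc g w))

end VectorGBundle

end Bundles

end

/-! Existence comes from averaging. A local trivialization `e` carries a trivial connection, and a
bump function `b` compactly supported in its base set localizes it. Summing the pullbacks of this
localized connection along all arrows `g` out of `x`, with weight `b (tgt g)`, gives an operator on
`Γ(G₀, V)` whose Leibniz rule is scaled by `∑ b (tgt g)` (`averagedConnection`). The sum is finite:
properness makes the set of arrows from `x` into the support compact, and étaleness makes it
discrete. It is smooth because nearby fibres are swept out by finitely many local sections of the
source (`exists_local_sections`). It is invariant because right multiplication by `k` permutes the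
arrows being summed (`sum_fiber_mul`) and the pullback along `g` corresponds under `k` to the
pullback along `g ∘ k` (`transportDeriv_mul`).

Only the orbit space is known to be paracompact, so bump functions are chosen whose images there are
locally finite and meet every orbit (`exists_locallyFinite_bumpFunctions`). The sum of the averaged
operators divided by the positive sum of the weights is an invariant connection. It restricts to a
connection, since an invariant section is its own transport along every arrow; this gives
nonemptiness of both affine spaces.

In a difference of two connections the terms in `dφ` cancel. For connections on invariant sections
this is already the claim. For invariant connections the difference is linear over all smooth
functions on `G₀`, hence is pointwise an `End V`-valued form (`exists_clm_of_map_smul`). This form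
is invariant because the germ of a section at the source of an arrow can be transported to the
target and extended (`exists_section_act`). -/

noncomputable section

/-! ### Smooth sections, derivatives and local diffeomorphisms -/

section BundleLemmas

variable {B : Type*} [NormedAddCommGroup B] [NormedSpace ℝ B]
  {M : Type*} [TopologicalSpace M] [ChartedSpace B M]
  {B' : Type*} [NormedAddCommGroup B'] [NormedSpace ℝ B']
  {N : Type*} [TopologicalSpace N] [ChartedSpace B' N]

/-- A map into a space of continuous linear maps with finite-dimensional source is smooth when its
evaluations are. -/
theorem contMDiffAt_clm_of_forall_apply {F₁ F₂ : Type*}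
    [NormedAddCommGroup F₁] [NormedSpace ℝ F₁] [FiniteDimensional ℝ F₁]
    [NormedAddCommGroup F₂] [NormedSpace ℝ F₂] {f : M → F₁ →L[ℝ] F₂} {x₀ : M}
    (h : ∀ v, ContMDiffAt 𝓘(ℝ, B) 𝓘(ℝ, F₂) ∞ (fun x => f x v) x₀) :
    ContMDiffAt 𝓘(ℝ, B) 𝓘(ℝ, F₁ →L[ℝ] F₂) ∞ f x₀ := by
  let b := Module.finBasis ℝ F₁
  let Φ := (b.equivFunL.arrowCongr (ContinuousLinearEquiv.refl ℝ F₂)).trans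
    (ContinuousLinearEquiv.piRing (𝕜 := ℝ) (E := F₂) (Fin (Module.finrank ℝ F₁)))
  have h1 : ContMDiffAt 𝓘(ℝ, B) 𝓘(ℝ, Fin (Module.finrank ℝ F₁) → F₂) ∞ (fun x => Φ (f x)) x₀ := by
    rw [contMDiffAt_pi_space]
    intro i
    refine (h (b.equivFunL.symm (Pi.single i 1))).congr_of_eventuallyEq (Eventually.of_forall ?_)
    intro x
    simp [Φ, ContinuousLinearEquiv.piRing, LinearEquiv.piRing_apply]
  have h2 := Φ.symm.contDiff.contMDiff.contMDiffAt.comp x₀ h1 (n := ∞)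
  refine h2.congr_of_eventuallyEq (Eventually.of_forall fun x => ?_)
  simp

/-- A section of the bundle `Hom(V₁, V₂)`, with `V₁` of finite rank, is smooth at a point when its
values on the vectors which are constant in the preferred trivialization of `V₁` are smooth. -/
theorem contMDiffAt_hom_section_of_forall_apply {F₁ F₂ : Type*}
    [NormedAddCommGroup F₁] [NormedSpace ℝ F₁] [FiniteDimensional ℝ F₁]
    [NormedAddCommGroup F₂] [NormedSpace ℝ F₂]
    {V₁ V₂ : M → Type*} [TopologicalSpace (TotalSpace F₁ V₁)] [TopologicalSpace (TotalSpace F₂ V₂)]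
    [∀ x, AddCommGroup (V₁ x)] [∀ x, Module ℝ (V₁ x)] [∀ x, TopologicalSpace (V₁ x)]
    [∀ x, AddCommGroup (V₂ x)] [∀ x, Module ℝ (V₂ x)] [∀ x, TopologicalSpace (V₂ x)]
    [∀ x, IsTopologicalAddGroup (V₂ x)] [∀ x, ContinuousSMul ℝ (V₂ x)]
    [FiberBundle F₁ V₁] [VectorBundle ℝ F₁ V₁] [FiberBundle F₂ V₂] [VectorBundle ℝ F₂ V₂]
    {A : ∀ x, V₁ x →L[ℝ] V₂ x} {x₀ : M}
    (h : ∀ v : F₁, ContMDiffAt 𝓘(ℝ, B) (𝓘(ℝ, B).prod 𝓘(ℝ, F₂)) ∞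
      (fun x => TotalSpace.mk' F₂ x (A x ((trivializationAt F₁ V₁ x₀).symm x v))) x₀) :
    ContMDiffAt 𝓘(ℝ, B) (𝓘(ℝ, B).prod 𝓘(ℝ, F₁ →L[ℝ] F₂)) ∞
      (fun x => TotalSpace.mk' (F₁ →L[ℝ] F₂) (E := fun x => V₁ x →L[ℝ] V₂ x) x (A x)) x₀ := by
  rw [contMDiffAt_hom_bundle]
  refine ⟨contMDiffAt_id, contMDiffAt_clm_of_forall_apply fun v => ?_⟩
  have := (contMDiffAt_totalSpace.1 (h v)).2
  refine this.congr_of_eventuallyEq ?_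
  filter_upwards [(trivializationAt F₁ V₁ x₀).open_baseSet.mem_nhds
    (mem_baseSet_trivializationAt F₁ V₁ x₀), (trivializationAt F₂ V₂ x₀).open_baseSet.mem_nhds
    (mem_baseSet_trivializationAt F₂ V₂ x₀)] with x hx hx'
  simp [ContinuousLinearMap.inCoordinates_eq hx hx', TotalSpace.mk']

/-- The derivative of a smooth vector-valued function along a smooth vector field is smooth. -/
theorem ContMDiffAt.mvfderiv_apply [IsManifold 𝓘(ℝ, B) ∞ M] {F : Type*}
    [NormedAddCommGroup F] [NormedSpace ℝ F] {u : M → F} {x₀ : M}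
    (hu : ContMDiffAt 𝓘(ℝ, B) 𝓘(ℝ, F) ∞ u x₀) {X : ∀ x : M, TangentSpace 𝓘(ℝ, B) x}
    (hX : ContMDiffAt 𝓘(ℝ, B) (𝓘(ℝ, B).prod 𝓘(ℝ, B)) ∞
      (fun x => (⟨x, X x⟩ : TotalSpace B (TangentSpace 𝓘(ℝ, B) : M → Type _))) x₀) :
    ContMDiffAt 𝓘(ℝ, B) 𝓘(ℝ, F) ∞ (fun x => mvfderiv 𝓘(ℝ, B) u x (X x)) x₀ := by
  have : IsManifold 𝓘(ℝ, B) 1 M := IsManifold.of_le (n := ∞) (by simp)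
  have h1 := hu.mfderiv_const (m := ∞) (by simp)
  have h2 := ContMDiffAt.clm_apply_of_inCoordinates (F₂ := F) (b₁ := id) (b₂ := u)
    (E₂ := (TangentSpace 𝓘(ℝ, F) : F → Type _)) (ϕ := fun x => mfderiv 𝓘(ℝ, B) 𝓘(ℝ, F) u x)
    (v := X) h1 hX hu
  have h3 := (contMDiffAt_totalSpace.1 h2).2
  refine h3.congr_of_eventuallyEq (Eventually.of_forall fun x => ?_)
  simp [mvfderiv]
  rfl

/-- Two functions with the same germ have the same derivative. -/
theorem Filter.EventuallyEq.mvfderiv_eq {F : Type*} [NormedAddCommGroup F] [NormedSpace ℝ F]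
    {u u' : M → F} {x : M} (h : u =ᶠ[𝓝 x] u') :
    mvfderiv 𝓘(ℝ, B) u x = mvfderiv 𝓘(ℝ, B) u' x := by
  ext v
  have := h.mfderiv_eq (I := 𝓘(ℝ, B)) (I' := 𝓘(ℝ, F))
  exact congrArg (fun L : B →L[ℝ] F => L v) this

theorem mvfderiv_comp_apply_vec {F : Type*} [NormedAddCommGroup F] [NormedSpace ℝ F]
    {u : N → F} {f : M → N} {x : M} (hu : MDifferentiableAt 𝓘(ℝ, B') 𝓘(ℝ, F) u (f x))
    (hf : MDifferentiableAt 𝓘(ℝ, B) 𝓘(ℝ, B') f x) (v : TangentSpace 𝓘(ℝ, B) x) :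
    mvfderiv 𝓘(ℝ, B) (u ∘ f) x v =
      mvfderiv 𝓘(ℝ, B') u (f x) (mfderiv 𝓘(ℝ, B) 𝓘(ℝ, B') f x v) := by
  have := mfderiv_comp x hu hf
  exact congrArg (fun L : B →L[ℝ] F => L v) this

/-- A local diffeomorphism has a smooth local inverse. -/
theorem IsLocalDiffeomorphAt.exists_local_inverse {f : M → N} {x : M}
    (hf : IsLocalDiffeomorphAt 𝓘(ℝ, B) 𝓘(ℝ, B') ∞ f x) :
    ∃ σ : N → M, σ (f x) = x ∧ (∀ᶠ y in 𝓝 (f x), f (σ y) = y) ∧ (∀ᶠ z in 𝓝 x, σ (f z) = z) ∧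
      ∀ᶠ y in 𝓝 (f x), ContMDiffAt 𝓘(ℝ, B') 𝓘(ℝ, B) ∞ σ y := by
  refine ⟨hf.localInverse, hf.localInverse_left_inv hf.localInverse_mem_target,
    hf.localInverse_eventuallyEq_right, hf.localInverse_eventuallyEq_left, ?_⟩
  filter_upwards [hf.localInverse_open_source.mem_nhds hf.localInverse_mem_source] with y hy
  exact hf.localInverse_contMDiffOn.contMDiffAt (hf.localInverse_open_source.mem_nhds hy)

/-- The derivative of a function at a point of a local section of a local diffeomorphism `f`,
precomposed with the inverse of the derivative of `f`, is the derivative of the function along the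
section. -/
theorem IsLocalDiffeomorphAt.mvfderiv_inverse_apply {F : Type*}
    [NormedAddCommGroup F] [NormedSpace ℝ F] {f : M → N} {σ : N → M} {y : N}
    (hf : IsLocalDiffeomorphAt 𝓘(ℝ, B) 𝓘(ℝ, B') ∞ f (σ y)) (hσ : ∀ᶠ z in 𝓝 y, f (σ z) = z)
    (hσ' : MDifferentiableAt 𝓘(ℝ, B') 𝓘(ℝ, B) σ y) {u : M → F}
    (hu : MDifferentiableAt 𝓘(ℝ, B) 𝓘(ℝ, F) u (σ y)) (v : B') :
    mvfderiv 𝓘(ℝ, B) u (σ y) ((mfderiv 𝓘(ℝ, B) 𝓘(ℝ, B') f (σ y)).inverse v) =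
      mvfderiv 𝓘(ℝ, B') (u ∘ σ) y v := by
  refine Eq.trans ?_ (mvfderiv_comp_apply_vec hu hσ' v).symm
  refine congrArg (mvfderiv 𝓘(ℝ, B) u (σ y)) ?_
  have h1 : f ∘ σ =ᶠ[𝓝 y] id := hσ
  have h2 := h1.mfderiv_eq (I := 𝓘(ℝ, B')) (I' := 𝓘(ℝ, B'))
  have hfd := hf.mdifferentiableAt (by simp)
  have h3 := mfderiv_comp y hfd hσ'
  -- Differentiating `f ∘ σ = id` gives `df (dσ v) = v`; as `df` is invertible, `df⁻¹ v = dσ v`.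
  have h4 : mfderiv 𝓘(ℝ, B) 𝓘(ℝ, B') f (σ y) (mfderiv 𝓘(ℝ, B') 𝓘(ℝ, B) σ y v) = v := by
    have h5 := h3.symm.trans h2
    rw [mfderiv_id] at h5
    exact congrArg (fun L : B' →L[ℝ] B' => L v) h5
  have h6 := hf.mfderivToContinuousLinearEquiv_coe (by simp)
  set e := hf.mfderivToContinuousLinearEquiv (by simp) with he
  rw [← h6] at h4 ⊢
  rw [ContinuousLinearMap.inverse_equiv]
  exact e.symm_apply_eq.2 h4.symm

/-- Every germ of a smooth section extends to a global smooth section. -/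
theorem exists_contMDiffSection_eventuallyEq [T2Space M] [FiniteDimensional ℝ B]
    [IsManifold 𝓘(ℝ, B) ∞ M] {F : Type*}
    [NormedAddCommGroup F] [NormedSpace ℝ F]
    {V : M → Type*} [TopologicalSpace (TotalSpace F V)]
    [∀ x, AddCommGroup (V x)] [∀ x, Module ℝ (V x)] [∀ x, TopologicalSpace (V x)]
    [FiberBundle F V] [VectorBundle ℝ F V] {s : ∀ x, V x} {x₀ : M}
    (hs : ∀ᶠ x in 𝓝 x₀, ContMDiffAt 𝓘(ℝ, B) (𝓘(ℝ, B).prod 𝓘(ℝ, F)) ∞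
      (fun x => TotalSpace.mk' F x (s x)) x) :
    ∃ ξ : Cₛ^∞⟮𝓘(ℝ, B); F, V⟯, ∀ᶠ x in 𝓝 x₀, ξ x = s x := by
  obtain ⟨u, hu, hu', hx⟩ := eventually_nhds_iff.1 hs
  -- A bump function equal to `1` near `x₀` and supported where `s` is smooth; extending `ψ • s` by
  -- zero does not change the germ.
  obtain ⟨ψ, -, hψ⟩ := (SmoothBumpFunction.nhds_basis_tsupport (I := 𝓘(ℝ, B)) x₀).mem_iff.1
    (hu'.mem_nhds hx)
  refine ⟨⟨_, ContMDiffOn.smul_section_of_tsupport (s := s) (ψ := ψ) ψ.contMDiff.contMDiffOn hu' hψ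
    fun x hx => (hu x hx).contMDiffWithinAt⟩, ?_⟩
  filter_upwards [ψ.eventuallyEq_one] with x hx
  change ψ x • s x = s x
  rw [hx, Pi.one_apply, one_smul]

end BundleLemmas

/-! ### Arrows, the orbit space and local sections of the source map -/

namespace LieGroupoid

variable {B₀ B₁ : Type*} [NormedAddCommGroup B₀] [NormedSpace ℝ B₀]
  [NormedAddCommGroup B₁] [NormedSpace ℝ B₁]
  {G₀ G₁ : Type*} [TopologicalSpace G₀] [ChartedSpace B₀ G₀]
  [TopologicalSpace G₁] [ChartedSpace B₁ G₁]
  {G : LieGroupoid B₀ B₁ G₀ G₁}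

/-- The inverse of an arrow from `x` to `y`, as an arrow from `y` to `x`. -/
def invHom {x y : G₀} (g : G.Hom x y) : G.Hom y x :=
  ⟨G.inv g.1, (G.src_inv _).trans g.2.2, (G.tgt_inv _).trans g.2.1⟩

theorem invHom_comp {x y : G₀} (g : G.Hom x y) : G.comp (G.invHom g) g = G.id x := by
  obtain ⟨g, rfl, rfl⟩ := g
  exact Subtype.ext (G.inv_mul g)

theorem comp_invHom {x y : G₀} (g : G.Hom x y) : G.comp g (G.invHom g) = G.id y := by
  obtain ⟨g, rfl, rfl⟩ := g
  exact Subtype.ext (G.mul_inv g)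

/-- Right multiplication by an arrow `k` is a bijection from the arrows that start at the target of
`k` to those that start at its source. -/
theorem bijOn_mul_right (k : G₁) :
    Set.BijOn (fun g => G.mul g k) {g | G.src g = G.tgt k} {g | G.src g = G.src k} := by
  refine ⟨fun g hg => G.src_mul g k hg, fun g hg g' hg' h => ?_, fun g hg => ?_⟩
  · have key : ∀ a, G.src a = G.tgt k → G.mul (G.mul a k) (G.inv k) = a := fun a ha => by
      rw [G.mul_assoc _ _ _ ha (G.tgt_inv k).symm, G.mul_inv, ← ha, G.mul_unit]
    rw [← key g hg, ← key g' hg']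
    exact congrArg (fun a => G.mul a (G.inv k)) h
  · have hg1 : G.src g = G.tgt (G.inv k) := by rw [G.tgt_inv]; exact hg
    refine ⟨G.mul g (G.inv k), ?_, ?_⟩
    · change G.src _ = _
      rw [G.src_mul _ _ hg1, G.src_inv]
    · change G.mul _ _ = _
      rw [G.mul_assoc _ _ _ hg1 (G.src_inv k), G.inv_mul, ← hg, G.mul_unit]

/-- The projection onto the orbit space. -/
def orbitMap (G : LieGroupoid B₀ B₁ G₀ G₁) (x : G₀) : G.OrbitSpace := Quotient.mk G.orbitSetoid x

theorem orbitMap_eq_iff {x y : G₀} : G.orbitMap x = G.orbitMap y ↔ Nonempty (G.Hom x y) :=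
  Quotient.eq (r := G.orbitSetoid)

theorem orbitMap_surjective : Function.Surjective G.orbitMap := Quotient.mk_surjective

theorem continuous_orbitMap : Continuous G.orbitMap := continuous_quot_mk

theorem orbitMap_tgt (g : G₁) : G.orbitMap (G.tgt g) = G.orbitMap (G.src g) :=
  (orbitMap_eq_iff.2 ⟨G.arrow g⟩).symm

/-- The saturation of `U` is `tgt (src ⁻¹ U)`, and the target map, a local diffeomorphism, is open.
-/
theorem IsEtale.isOpenMap_orbitMap (hG : G.IsEtale) : IsOpenMap G.orbitMap := by
  intro U hU
  have h : G.orbitMap ⁻¹' (G.orbitMap '' U) = G.tgt '' (G.src ⁻¹' U) := by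
    ext y
    constructor
    · rintro ⟨x, hx, hxy⟩
      obtain ⟨g, rfl, rfl⟩ := orbitMap_eq_iff.1 hxy
      exact ⟨g, hx, rfl⟩
    · rintro ⟨g, hg, rfl⟩
      exact ⟨_, hg, (orbitMap_tgt g).symm⟩
  have h2 : IsOpen (G.orbitMap ⁻¹' (G.orbitMap '' U)) := by
    rw [h]
    exact hG.2.isOpenMap _ (hU.preimage G.src.contMDiff.continuous)
  exact h2

/-- In an orbifold groupoid, the arrows from points near `y₀` to a compact set `K` are the values of
finitely many local sections of the source map. -/
theorem IsOrbifoldGroupoid.exists_local_sections [T2Space G₀] [T2Space G₁]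
    (hG : G.IsOrbifoldGroupoid) {K : Set G₀} (hK : IsCompact K) (y₀ : G₀) :
    ∃ (T : Finset G₁) (σ : G₁ → G₀ → G₁),
      (∀ g ∈ T, G.tgt g ∈ K ∧ σ g y₀ = g ∧ (∀ᶠ y in 𝓝 y₀, G.src (σ g y) = y) ∧
        ∀ᶠ y in 𝓝 y₀, ContMDiffAt 𝓘(ℝ, B₀) 𝓘(ℝ, B₁) ∞ (σ g) y) ∧
      ∀ᶠ y in 𝓝 y₀, Set.InjOn (fun g => σ g y) T ∧
        ∀ h, G.src h = y → G.tgt h ∈ K → ∃ g ∈ T, σ g y = h := by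
  choose σ hσ1 hσ2 hσ3 hσ4 using fun g => (hG.isEtale.1 g).exists_local_inverse
  have hP : IsProperMap fun g : G₁ => (G.src g, G.tgt g) := hG.isProper
  have hA : IsCompact ((fun g : G₁ => (G.src g, G.tgt g)) ⁻¹' ({y₀} ×ˢ K)) :=
    hP.isCompact_preimage (isCompact_singleton.prod hK)
  set A := (fun g : G₁ => (G.src g, G.tgt g)) ⁻¹' ({y₀} ×ˢ K) with hAdef
  have hmem : ∀ g, g ∈ A ↔ G.src g = y₀ ∧ G.tgt g ∈ K := fun g => by simp [hAdef]
  -- On the neighbourhood of `g` where `σ g ∘ src` is the identity, an arrow with source `y₀` must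
  -- equal `σ g y₀ = g`. So `A` is discrete as well as compact.
  have hfin : A.Finite := by
    obtain ⟨t, ht, htA⟩ := hA.elim_nhds_subcover (fun g => {z | σ g (G.src z) = z})
      (fun g _ => hσ3 g)
    refine t.finite_toSet.subset fun h hh => ?_
    obtain ⟨g, hg, hgh⟩ := Set.mem_iUnion₂.1 (htA hh)
    have h1 : σ g (G.src h) = h := hgh
    rw [((hmem h).1 hh).1, ← ((hmem g).1 (ht g hg)).1, hσ1] at h1
    exact h1 ▸ hg
  refine ⟨hfin.toFinset, σ, fun g hg => ?_, ?_⟩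
  · have hg' := (hmem g).1 (hfin.mem_toFinset.1 hg)
    refine ⟨hg'.2, ?_, ?_, ?_⟩
    · rw [← hg'.1]; exact hσ1 g
    · rw [← hg'.1]; exact hσ2 g
    · rw [← hg'.1]; exact hσ4 g
  · refine Filter.Eventually.and ?_ ?_
    · have h1 : ∀ᶠ y in 𝓝 y₀, ∀ g ∈ hfin.toFinset, ∀ g' ∈ hfin.toFinset, g ≠ g' →
          σ g y ≠ σ g' y := by
        refine (eventually_all_finset _).2 fun g hg => (eventually_all_finset _).2 fun g' hg' => ?_
        by_cases hgg : g = g'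
        · exact Eventually.of_forall fun y h => absurd hgg h
        have hg1 := ((hmem g).1 (hfin.mem_toFinset.1 hg)).1
        have hg1' := ((hmem g').1 (hfin.mem_toFinset.1 hg')).1
        have c1 : ContinuousAt (σ g) y₀ := hg1 ▸ (hσ4 g).self_of_nhds.continuousAt
        have c2 : ContinuousAt (σ g') y₀ := hg1' ▸ (hσ4 g').self_of_nhds.continuousAt
        have hne : σ g y₀ ≠ σ g' y₀ := by
          have e1 := hσ1 g
          have e2 := hσ1 g'
          rw [hg1] at e1
          rw [hg1'] at e2
          rwa [e1, e2]
        filter_upwards [(c1.ne_iff_eventually_ne c2).1 hne] with y hy _ using hy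
      filter_upwards [h1] with y hy g hg g' hg' h
      by_contra hne
      exact hy g hg g' hg' hne h
    · let O : Set G₁ := ⋃ g ∈ A, interior {z | σ g (G.src z) = z}
      have hO : IsOpen O := isOpen_biUnion fun _ _ => isOpen_interior
      have hC : IsClosed ((fun g : G₁ => (G.src g, G.tgt g)) '' Oᶜ) :=
        hP.isClosedMap _ hO.isClosed_compl
      obtain ⟨u, v, hu, hv, hyu, hKv, huv⟩ := generalized_tube_lemma
        (isCompact_singleton (x := y₀)) hK hC.isOpen_compl (by
          rintro ⟨y, z⟩ ⟨rfl, hz⟩ ⟨g, hg, hgeq⟩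
          refine hg ?_
          have hgA : g ∈ A := by
            simp only [Prod.mk.injEq] at hgeq
            exact (hmem g).2 ⟨hgeq.1, hgeq.2 ▸ hz⟩
          exact Set.mem_iUnion₂.2 ⟨g, hgA, mem_interior_iff_mem_nhds.2 (hσ3 g)⟩)
      filter_upwards [hu.mem_nhds (hyu rfl)] with y hy h hsrc htgt
      have : h ∈ O := by
        by_contra hn
        exact huv (show (G.src h, G.tgt h) ∈ u ×ˢ v from ⟨hsrc ▸ hy, hKv htgt⟩) ⟨h, hn, rfl⟩
      obtain ⟨g, hg, hgh⟩ := Set.mem_iUnion₂.1 this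
      refine ⟨g, hfin.mem_toFinset.2 hg, ?_⟩
      rw [← hsrc]
      have hh : h ∈ {z | σ g (G.src z) = z} := interior_subset hgh
      exact hh

end LieGroupoid

/-! ### Smoothness of the action on fibres -/

namespace VectorGBundle

variable {B₀ B₁ : Type*} [NormedAddCommGroup B₀] [NormedSpace ℝ B₀]
  [NormedAddCommGroup B₁] [NormedSpace ℝ B₁]
  {G₀ G₁ : Type*} [TopologicalSpace G₀] [ChartedSpace B₀ G₀]
  [TopologicalSpace G₁] [ChartedSpace B₁ G₁]
  {G : LieGroupoid B₀ B₁ G₀ G₁}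
  {F : Type*} [NormedAddCommGroup F] [NormedSpace ℝ F]
  {V : G₀ → Type*} [TopologicalSpace (TotalSpace F V)]
  [∀ x, AddCommGroup (V x)] [∀ x, Module ℝ (V x)] [∀ x, TopologicalSpace (V x)]
  [FiberBundle F V] [VectorBundle ℝ F V] [ContMDiffVectorBundle ∞ F V 𝓘(ℝ, B₀)]
  (E : VectorGBundle G F V)

@[simp] theorem act_invHom_act {x y : G₀} (g : G.Hom x y) (v : V x) :
    E.act (G.invHom g) (E.act g v) = v := by
  rw [← E.act_comp, LieGroupoid.invHom_comp, E.act_id]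

@[simp] theorem act_act_invHom {x y : G₀} (g : G.Hom x y) (v : V y) :
    E.act g (E.act (G.invHom g) v) = v := by
  rw [← E.act_comp, LieGroupoid.comp_invHom, E.act_id]

/-- The action of a smooth family of arrows on a smooth family of vectors is smooth. -/
theorem contMDiffAt_act {B : Type*} [NormedAddCommGroup B] [NormedSpace ℝ B]
    {M : Type*} [TopologicalSpace M] [ChartedSpace B M] {α : M → G₁} {p f : M → TotalSpace F V}
    {m₀ : M} (hα : ContMDiffAt 𝓘(ℝ, B) 𝓘(ℝ, B₁) ∞ α m₀)
    (hp : ContMDiffAt 𝓘(ℝ, B) (𝓘(ℝ, B₀).prod 𝓘(ℝ, F)) ∞ p m₀)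
    (hf : ∀ᶠ m in 𝓝 m₀, ∃ g : G.Hom (p m).proj (f m).proj, g.1 = α m ∧ (f m).2 = E.act g (p m).2) :
    ContMDiffAt 𝓘(ℝ, B) (𝓘(ℝ, B₀).prod 𝓘(ℝ, F)) ∞ f m₀ := by
  classical
  -- Lift of `p` to the pullback bundle. The base point of `p m` agrees with the source of `α m`
  -- only propositionally and only near `m₀`, hence the cast and the value `0` elsewhere.
  let q : M → TotalSpace F (G.src *ᵖ V) := fun m =>
    ⟨α m, (if h : (p m).proj = G.src (α m) then h ▸ (p m).2 else 0 : V (G.src (α m)))⟩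
  have hq : ∀ m, (p m).proj = G.src (α m) →
      (⟨G.src (q m).proj, (q m).2⟩ : TotalSpace F V) = p m := by
    intro m h
    have key : ∀ (P : TotalSpace F V) (x : G₀) (h : P.proj = x),
        (⟨x, h ▸ P.2⟩ : TotalSpace F V) = P := by rintro P _ rfl; rfl
    simp only [q, dif_pos h]
    exact key _ _ h
  have hev : ∀ᶠ m in 𝓝 m₀, (p m).proj = G.src (α m) := by
    filter_upwards [hf] with m ⟨g, hg, _⟩
    rw [← hg, g.2.1]
  have hq' : ContMDiffAt 𝓘(ℝ, B) (𝓘(ℝ, B₁).prod 𝓘(ℝ, F)) ∞ q m₀ := by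
    refine contMDiffAt_totalSpace.2 ⟨hα, ?_⟩
    have h2 := (contMDiffAt_totalSpace.1 hp).2
    rw [hev.self_of_nhds] at h2
    refine h2.congr_of_eventuallyEq ?_
    filter_upwards [hev] with m hm
    rw [← hq m hm]
    rfl
  refine (E.contMDiff_act.contMDiffAt.comp m₀ hq').congr_of_eventuallyEq ?_
  filter_upwards [hf, hev] with m ⟨g, hg, hfm⟩ hm
  have key : ∀ (P Q : TotalSpace F V) (R : TotalSpace F (G.src *ᵖ V)) (g : G.Hom P.proj Q.proj),
      g.1 = R.proj → (⟨G.src R.proj, R.2⟩ : TotalSpace F V) = P → Q.2 = E.act g P.2 →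
      Q = ⟨G.tgt R.proj, E.act (G.arrow R.proj) R.2⟩ := by
    rintro P ⟨y, w⟩ R ⟨g, hg1, hg2⟩ h rfl hQ
    change g = R.proj at h
    subst h
    change G.tgt R.proj = y at hg2
    subst hg2
    exact congrArg _ hQ
  exact key (p m) (f m) (q m) g hg (hq m hm) hfm

end VectorGBundle

theorem Bundle.Trivialization.eventually_map_mem_baseSet {F X Y : Type*} [TopologicalSpace F]
    [TopologicalSpace X] [TopologicalSpace Y] {V : Y → Type*} [TopologicalSpace (TotalSpace F V)]
    (e : Trivialization F (TotalSpace.proj : TotalSpace F V → Y)) {f : X → Y} (hf : Continuous f)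
    {x : X} (hx : f x ∈ e.baseSet) : ∀ᶠ x' in 𝓝 x, f x' ∈ e.baseSet :=
  hf.continuousAt.eventually_mem (e.open_baseSet.mem_nhds hx)

namespace LieGroupoid

variable {B₀ B₁ : Type*} [NormedAddCommGroup B₀] [NormedSpace ℝ B₀]
  [NormedAddCommGroup B₁] [NormedSpace ℝ B₁]
  {G₀ G₁ : Type*} [TopologicalSpace G₀] [ChartedSpace B₀ G₀]
  [TopologicalSpace G₁] [ChartedSpace B₁ G₁]
  {G : LieGroupoid B₀ B₁ G₀ G₁}

/-- An element of the arrow space with source `x`, as an arrow from `x` to its target. -/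
def homOfSrc (G : LieGroupoid B₀ B₁ G₀ G₁) {x : G₀} {g : G₁} (h : G.src g = x) :
    G.Hom x (G.tgt g) := ⟨g, h, rfl⟩

theorem IsEtale.exists_mfderiv_src_eq (hG : G.IsEtale) (g : G₁) :
    ∃ Φ : B₁ ≃L[ℝ] B₀, (Φ : B₁ →L[ℝ] B₀) = mfderiv 𝓘(ℝ, B₁) 𝓘(ℝ, B₀) G.src g :=
  ⟨(hG.1 g).mfderivToContinuousLinearEquiv (by simp),
    (hG.1 g).mfderivToContinuousLinearEquiv_coe (by simp)⟩

theorem IsEtale.mfderiv_src_inverse_apply (hG : G.IsEtale) (g : G₁) (v : B₀) :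
    (mfderiv 𝓘(ℝ, B₁) 𝓘(ℝ, B₀) G.src g : B₁ →L[ℝ] B₀)
      ((mfderiv 𝓘(ℝ, B₁) 𝓘(ℝ, B₀) G.src g : B₁ →L[ℝ] B₀).inverse v) = v := by
  obtain ⟨Φ, h⟩ := hG.exists_mfderiv_src_eq g
  have key : (Φ : B₁ →L[ℝ] B₀) ((Φ : B₁ →L[ℝ] B₀).inverse v) = v := by
    simp [ContinuousLinearMap.inverse_equiv]
  rwa [h] at key

theorem IsEtale.inverse_mfderiv_src_apply (hG : G.IsEtale) (g : G₁) (w : B₁) :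
    (mfderiv 𝓘(ℝ, B₁) 𝓘(ℝ, B₀) G.src g : B₁ →L[ℝ] B₀).inverse
      ((mfderiv 𝓘(ℝ, B₁) 𝓘(ℝ, B₀) G.src g : B₁ →L[ℝ] B₀) w) = w := by
  obtain ⟨Φ, h⟩ := hG.exists_mfderiv_src_eq g
  have key : (Φ : B₁ →L[ℝ] B₀).inverse ((Φ : B₁ →L[ℝ] B₀) w) = w := by
    simp [ContinuousLinearMap.inverse_equiv]
  rwa [h] at key

end LieGroupoid

/-! ### Transport of sections by arrows and its derivative -/

namespace VectorGBundle

variable {B₀ B₁ : Type*} [NormedAddCommGroup B₀] [NormedSpace ℝ B₀]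
  [NormedAddCommGroup B₁] [NormedSpace ℝ B₁]
  {G₀ G₁ : Type*} [TopologicalSpace G₀] [ChartedSpace B₀ G₀]
  [TopologicalSpace G₁] [ChartedSpace B₁ G₁]
  {G : LieGroupoid B₀ B₁ G₀ G₁}
  {F : Type*} [NormedAddCommGroup F] [NormedSpace ℝ F]
  {V : G₀ → Type*} [TopologicalSpace (TotalSpace F V)]
  [∀ x, AddCommGroup (V x)] [∀ x, Module ℝ (V x)] [∀ x, TopologicalSpace (V x)]
  [FiberBundle F V] [VectorBundle ℝ F V] [ContMDiffVectorBundle ∞ F V 𝓘(ℝ, B₀)]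
  (E : VectorGBundle G F V)
  (e : Trivialization F (TotalSpace.proj : TotalSpace F V → G₀))

/-- The coordinates, in a local trivialization at the target, of the transport of a section by an
arrow. -/
def transportCoord (ξ : ∀ x, V x) (g : G₁) : F :=
  (e ⟨G.tgt g, E.act (G.arrow g) (ξ (G.src g))⟩).2

/-- The derivative of `transportCoord` at an arrow `g`, as a function of a tangent vector at the
source of `g`. -/
def transportDeriv (ξ : ∀ x, V x) (g : G₁) : B₀ →L[ℝ] F :=
  (mvfderiv 𝓘(ℝ, B₁) (E.transportCoord e ξ) g : B₁ →L[ℝ] F).comp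
    -- This is a genuine inverse when the groupoid is étale.
    (mfderiv 𝓘(ℝ, B₁) 𝓘(ℝ, B₀) G.src g : B₁ →L[ℝ] B₀).inverse

variable {e}

theorem transportCoord_hom (ξ : ∀ x, V x) {x y : G₀} (g : G.Hom x y) :
    E.transportCoord e ξ g.1 = (e ⟨y, E.act g (ξ x)⟩).2 := by
  obtain ⟨g, rfl, rfl⟩ := g
  rfl

variable [MemTrivializationAtlas e]

theorem contMDiffAt_transportCoord (ξ : Cₛ^∞⟮𝓘(ℝ, B₀); F, V⟯) {g : G₁}
    (hg : G.tgt g ∈ e.baseSet) :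
    ContMDiffAt 𝓘(ℝ, B₁) 𝓘(ℝ, F) ∞ (E.transportCoord e ξ) g := by
  have h1 : ContMDiffAt 𝓘(ℝ, B₁) (𝓘(ℝ, B₀).prod 𝓘(ℝ, F)) ∞
      (fun g => (⟨G.tgt g, E.act (G.arrow g) (ξ (G.src g))⟩ : TotalSpace F V)) g :=
    E.contMDiffAt_act (α := id) (p := fun g => ⟨G.src g, ξ (G.src g)⟩) contMDiffAt_id
      (ξ.contMDiff.contMDiffAt.comp g G.src.contMDiff.contMDiffAt)
      (Eventually.of_forall fun g => ⟨G.arrow g, rfl, rfl⟩)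
  exact ((Bundle.Trivialization.contMDiffAt_iff (IB := 𝓘(ℝ, B₀)) (e := e)
    (by simpa [e.mem_source] using hg)).1 h1).2

theorem transportCoord_add {ξ η : ∀ x, V x} {g : G₁} (hg : G.tgt g ∈ e.baseSet) :
    E.transportCoord e (ξ + η) g = E.transportCoord e ξ g + E.transportCoord e η g := by
  simp only [transportCoord, Pi.add_apply, map_add]
  exact (e.linear ℝ hg).map_add _ _

theorem transportCoord_smul {φ : G₀ → ℝ} {ξ : ∀ x, V x} {g : G₁} (hg : G.tgt g ∈ e.baseSet) :
    E.transportCoord e (fun x => φ x • ξ x) g = φ (G.src g) • E.transportCoord e ξ g := by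
  simp only [transportCoord, map_smul]
  exact (e.linear ℝ hg).map_smul _ _

theorem transportDeriv_add (ξ η : Cₛ^∞⟮𝓘(ℝ, B₀); F, V⟯) {g : G₁} (hg : G.tgt g ∈ e.baseSet) :
    E.transportDeriv e ⇑(ξ + η) g = E.transportDeriv e ξ g + E.transportDeriv e η g := by
  have h1 : E.transportCoord e ⇑(ξ + η) =ᶠ[𝓝 g] E.transportCoord e ξ + E.transportCoord e η := by
    filter_upwards [e.eventually_map_mem_baseSet G.tgt.contMDiff.continuous hg] with h hh
    exact E.transportCoord_add hh
  have h2 := h1.mvfderiv_eq (B := B₁)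
  rw [mvfderiv_add ((E.contMDiffAt_transportCoord ξ hg).mdifferentiableAt (by simp))
    ((E.contMDiffAt_transportCoord η hg).mdifferentiableAt (by simp))] at h2
  unfold transportDeriv
  rw [h2]
  rfl

/-- Transport multiplies coordinates by `φ ∘ src`, and `d(φ ∘ src)` composed with the inverse of the
differential of `src` is `dφ`. -/
theorem transportDeriv_smul (hG : G.IsEtale)
    (φ : C^∞⟮𝓘(ℝ, B₀), G₀; ℝ⟯) (ξ : Cₛ^∞⟮𝓘(ℝ, B₀); F, V⟯) {g : G₁}
    (hg : G.tgt g ∈ e.baseSet) (v : B₀) :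
    E.transportDeriv e ⇑(φ • ξ) g v =
      (mvfderiv 𝓘(ℝ, B₀) φ (G.src g) : B₀ →L[ℝ] ℝ) v • E.transportCoord e ξ g +
        φ (G.src g) • E.transportDeriv e ξ g v := by
  have h1 : E.transportCoord e ⇑(φ • ξ) =ᶠ[𝓝 g] (φ ∘ G.src) • E.transportCoord e ξ := by
    filter_upwards [e.eventually_map_mem_baseSet G.tgt.contMDiff.continuous hg] with h hh
    exact E.transportCoord_smul hh
  have h2 := h1.mvfderiv_eq (B := B₁)
  have hφ : MDifferentiableAt 𝓘(ℝ, B₀) 𝓘(ℝ, ℝ) φ (G.src g) :=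
    φ.contMDiff.contMDiffAt.mdifferentiableAt (by simp)
  have hs : MDifferentiableAt 𝓘(ℝ, B₁) 𝓘(ℝ, B₀) G.src g :=
    G.src.contMDiff.contMDiffAt.mdifferentiableAt (by simp)
  rw [mvfderiv_smul (hφ.comp g hs)
    ((E.contMDiffAt_transportCoord ξ hg).mdifferentiableAt (by simp))] at h2
  have h3 := congrArg (fun L : B₁ →L[ℝ] F =>
    L ((mfderiv 𝓘(ℝ, B₁) 𝓘(ℝ, B₀) G.src g : B₁ →L[ℝ] B₀).inverse v)) h2
  refine h3.trans ?_
  have h4 := mvfderiv_comp_apply_vec hφ hs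
    ((mfderiv 𝓘(ℝ, B₁) 𝓘(ℝ, B₀) G.src g : B₁ →L[ℝ] B₀).inverse v)
  have h5 := hG.mfderiv_src_inverse_apply g v
  have h7 : mvfderiv 𝓘(ℝ, B₁) (φ ∘ G.src) g
      ((mfderiv 𝓘(ℝ, B₁) 𝓘(ℝ, B₀) G.src g : B₁ →L[ℝ] B₀).inverse v) =
        (mvfderiv 𝓘(ℝ, B₀) φ (G.src g) : B₀ →L[ℝ] ℝ) v := by
    refine h4.trans ?_
    exact congrArg (mvfderiv 𝓘(ℝ, B₀) φ (G.src g) : B₀ →L[ℝ] ℝ) h5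
  rw [← h7, add_comm]
  rfl

/-- The differential of `σ` inverts that of `src`. This replaces a derivative on `G₁` by one on
`G₀`, whose smoothness in `y` is accessible. -/
theorem transportDeriv_section (hG : G.IsEtale) (ξ : Cₛ^∞⟮𝓘(ℝ, B₀); F, V⟯) {σ : G₀ → G₁} {y : G₀}
    (hσ : ∀ᶠ z in 𝓝 y, G.src (σ z) = z) (hσ' : ContMDiffAt 𝓘(ℝ, B₀) 𝓘(ℝ, B₁) ∞ σ y)
    (hy : G.tgt (σ y) ∈ e.baseSet) (v : B₀) :
    E.transportDeriv e ξ (σ y) v =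
      (mvfderiv 𝓘(ℝ, B₀) (E.transportCoord e ξ ∘ σ) y : B₀ →L[ℝ] F) v :=
  (hG.1 (σ y)).mvfderiv_inverse_apply hσ (hσ'.mdifferentiableAt (by simp))
    ((E.contMDiffAt_transportCoord ξ hy).mdifferentiableAt (by simp)) v

/-- If `η` is near the target of `k` the transport of `ξ` by the arrows near `k`, then the
derivatives of the transport of `η` by `g` and of the transport of `ξ` by `g ∘ k` correspond to each
other. -/
theorem transportDeriv_mul (hG : G.IsEtale) {ξ η : Cₛ^∞⟮𝓘(ℝ, B₀); F, V⟯} {k g : G₁}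
    (h : ∀ᶠ h in 𝓝 k, η (G.tgt h) = E.act (G.arrow h) (ξ (G.src h)))
    (hgk : G.src g = G.tgt k) (hg : G.tgt g ∈ e.baseSet) (w : B₁) :
    E.transportDeriv e η g ((mfderiv 𝓘(ℝ, B₁) 𝓘(ℝ, B₀) G.tgt k : B₁ →L[ℝ] B₀) w) =
      E.transportDeriv e ξ (G.mul g k)
        ((mfderiv 𝓘(ℝ, B₁) 𝓘(ℝ, B₀) G.src k : B₁ →L[ℝ] B₀) w) := by
  obtain ⟨τ, hτ1, hτ2, hτ3, hτ4⟩ := (hG.1 g).exists_local_inverse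
  rw [hgk] at hτ1 hτ2 hτ4
  have ht : ContMDiffAt 𝓘(ℝ, B₁) 𝓘(ℝ, B₀) ∞ G.tgt k := G.tgt.contMDiff.contMDiffAt
  have hs : ContMDiffAt 𝓘(ℝ, B₁) 𝓘(ℝ, B₀) ∞ G.src k := G.src.contMDiff.contMDiffAt
  have hτ : ContMDiffAt 𝓘(ℝ, B₀) 𝓘(ℝ, B₁) ∞ τ (G.tgt k) := hτ4.self_of_nhds
  have hev : ∀ᶠ k' in 𝓝 k, G.src (τ (G.tgt k')) = G.tgt k' := ht.continuousAt.eventually hτ2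
  -- With `τ` a local section of the source through `g`, `μ` extends `g ∘ k` to a family of
  -- composites with the same sources as the `k'`. Transporting `η` by `τ (tgt k')` is transporting
  -- `ξ` by `μ k'`; the lemma is the derivative of this identity at `k`.
  let μ : G₁ → G₁ := fun k' => G.mul (τ (G.tgt k')) k'
  have hμk : μ k = G.mul g k := by simp only [μ, hτ1]
  have hμ : ContMDiffAt 𝓘(ℝ, B₁) 𝓘(ℝ, B₁) ∞ μ k := by
    have h1 : ContMDiffAt 𝓘(ℝ, B₁) (𝓘(ℝ, B₁).prod 𝓘(ℝ, B₁)) ∞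
        (fun k' => (τ (G.tgt k'), k')) k := (hτ.comp k ht).prodMk contMDiffAt_id
    -- Multiplication is smooth only on composable pairs, so smoothness is obtained within an open
    -- set where the pairs are composable.
    obtain ⟨U, hU, hUo, hkU⟩ := eventually_nhds_iff.1 hev
    have h2 : ContMDiffWithinAt 𝓘(ℝ, B₁) 𝓘(ℝ, B₁) ∞ μ U k :=
      ContMDiffWithinAt.comp k (G.contMDiffOn_mul _ (hU k hkU)) h1.contMDiffWithinAt
        (fun k' hk' => hU k' hk')
    exact h2.contMDiffAt (hUo.mem_nhds hkU)
  have hl : E.transportDeriv e η g ((mfderiv 𝓘(ℝ, B₁) 𝓘(ℝ, B₀) G.tgt k : B₁ →L[ℝ] B₀) w) =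
      mvfderiv 𝓘(ℝ, B₁) ((E.transportCoord e η ∘ τ) ∘ G.tgt) k w := by
    have h1 := E.transportDeriv_section hG η hτ2 hτ (by rwa [hτ1])
      ((mfderiv 𝓘(ℝ, B₁) 𝓘(ℝ, B₀) G.tgt k : B₁ →L[ℝ] B₀) w)
    rw [hτ1] at h1
    refine h1.trans (mvfderiv_comp_apply_vec (u := E.transportCoord e η ∘ τ) (f := G.tgt) (x := k)
      (ContMDiffAt.mdifferentiableAt (n := ∞) (ContMDiffAt.comp (G.tgt k)
        (E.contMDiffAt_transportCoord η ?_) hτ) (by simp))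
      (ht.mdifferentiableAt (by simp)) w).symm
    rwa [hτ1]
  have hgk' : G.tgt (G.mul g k) ∈ e.baseSet := by rwa [G.tgt_mul _ _ hgk]
  have hc : ContMDiffAt 𝓘(ℝ, B₁) 𝓘(ℝ, F) ∞ (E.transportCoord e ξ) (μ k) :=
    E.contMDiffAt_transportCoord ξ (hμk ▸ hgk')
  have hr : mvfderiv 𝓘(ℝ, B₁) (E.transportCoord e ξ ∘ μ) k w =
      E.transportDeriv e ξ (G.mul g k)
        ((mfderiv 𝓘(ℝ, B₁) 𝓘(ℝ, B₀) G.src k : B₁ →L[ℝ] B₀) w) := by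
    refine (mvfderiv_comp_apply_vec (hc.mdifferentiableAt (by simp))
      (hμ.mdifferentiableAt (by simp)) w).trans ?_
    rw [← hμk]
    refine congrArg (mvfderiv 𝓘(ℝ, B₁) (E.transportCoord e ξ) (μ k) : B₁ →L[ℝ] F) ?_
    -- Since `src ∘ μ = src` near `k`, the inverse of the differential of `src` at `μ k` sends the
    -- image of `w` under the differential of `src` at `k` to `dμ w`.
    have h1 : G.src ∘ μ =ᶠ[𝓝 k] G.src := by
      filter_upwards [hev] with k' hk'
      exact G.src_mul _ _ hk'
    have h2 := h1.mfderiv_eq (I := 𝓘(ℝ, B₁)) (I' := 𝓘(ℝ, B₀))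
    have h3 := mfderiv_comp (I := 𝓘(ℝ, B₁)) (I' := 𝓘(ℝ, B₁)) (I'' := 𝓘(ℝ, B₀)) (g := G.src) k
      (G.src.contMDiff.contMDiffAt.mdifferentiableAt (by simp)) (hμ.mdifferentiableAt (by simp))
    have h4 := congrArg (fun L : B₁ →L[ℝ] B₀ => L w) (h2.symm.trans h3)
    refine (hG.inverse_mfderiv_src_apply (μ k) _).symm.trans ?_
    exact congrArg (mfderiv 𝓘(ℝ, B₁) 𝓘(ℝ, B₀) G.src (μ k) : B₁ →L[ℝ] B₀).inverse h4.symm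
  rw [hl, ← hr]
  have hfun : (E.transportCoord e η ∘ τ) ∘ G.tgt =ᶠ[𝓝 k] E.transportCoord e ξ ∘ μ := by
    filter_upwards [hev, h] with k' hk' hξη
    have hc' : E.transportCoord e ξ (G.mul (τ (G.tgt k')) k') = (e ⟨_, E.act
        (G.comp (G.homOfSrc hk') (G.arrow k')) (ξ (G.src k'))⟩).2 :=
      E.transportCoord_hom ξ (G.comp (G.homOfSrc hk') (G.arrow k'))
    change E.transportCoord e η _ = E.transportCoord e ξ (G.mul _ _)
    rw [hc', E.act_comp, ← hξη]
    exact E.transportCoord_hom η (G.homOfSrc hk')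
  rw [hfun.mvfderiv_eq (B := B₁)]

end VectorGBundle

theorem Bundle.Trivialization.contMDiffAt_mk_symm {B B' : Type*}
    [NormedAddCommGroup B] [NormedSpace ℝ B] [NormedAddCommGroup B'] [NormedSpace ℝ B']
    {M N : Type*} [TopologicalSpace M] [ChartedSpace B M] [TopologicalSpace N] [ChartedSpace B' N]
    {F : Type*} [NormedAddCommGroup F] [NormedSpace ℝ F]
    {V : N → Type*} [TopologicalSpace (TotalSpace F V)]
    [∀ x, AddCommGroup (V x)] [∀ x, Module ℝ (V x)] [∀ x, TopologicalSpace (V x)]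
    [FiberBundle F V] [VectorBundle ℝ F V] [ContMDiffVectorBundle ∞ F V 𝓘(ℝ, B')]
    (e : Trivialization F (TotalSpace.proj : TotalSpace F V → N)) [MemTrivializationAtlas e]
    {f : M → N} {u : M → F} {x : M} (hf : ContMDiffAt 𝓘(ℝ, B) 𝓘(ℝ, B') ∞ f x)
    (hu : ContMDiffAt 𝓘(ℝ, B) 𝓘(ℝ, F) ∞ u x) (hx : f x ∈ e.baseSet) :
    ContMDiffAt 𝓘(ℝ, B) (𝓘(ℝ, B').prod 𝓘(ℝ, F)) ∞
      (fun y => (⟨f y, e.symm (f y) (u y)⟩ : TotalSpace F V)) x := by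
  have h1 : ContMDiffAt (𝓘(ℝ, B').prod 𝓘(ℝ, F)) (𝓘(ℝ, B').prod 𝓘(ℝ, F)) ∞
      e.toOpenPartialHomeomorph.symm (f x, u x) :=
    (e.contMDiffOn_symm).contMDiffAt (e.open_target.mem_nhds (e.mem_target.2 hx))
  refine (h1.comp x (hf.prodMk hu)).congr_of_eventuallyEq ?_
  filter_upwards [hf.continuousAt.eventually_mem (e.open_baseSet.mem_nhds hx)] with y hy
  exact e.mk_symm hy (u y)

/-! ### Sums over the arrows from a point to a compact set -/

namespace LieGroupoid

variable {B₀ B₁ : Type*} [NormedAddCommGroup B₀] [NormedSpace ℝ B₀]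
  [NormedAddCommGroup B₁] [NormedSpace ℝ B₁]
  {G₀ G₁ : Type*} [TopologicalSpace G₀] [T2Space G₀] [ChartedSpace B₀ G₀]
  [TopologicalSpace G₁] [T2Space G₁] [ChartedSpace B₁ G₁]
  {G : LieGroupoid B₀ B₁ G₀ G₁}

theorem IsOrbifoldGroupoid.finite_fiber (hG : G.IsOrbifoldGroupoid) {K : Set G₀} (hK : IsCompact K)
    (x : G₀) : {g | G.src g = x ∧ G.tgt g ∈ K}.Finite := by
  obtain ⟨T, σ, -, hT⟩ := hG.exists_local_sections hK x
  refine (T.finite_toSet.image fun g => σ g x).subset fun h hh => ?_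
  obtain ⟨g, hg, rfl⟩ := hT.self_of_nhds.2 h hh.1 hh.2
  exact ⟨g, hg, rfl⟩

/-- The arrows from a point to a compact set, as a finite set. -/
def IsOrbifoldGroupoid.fiber (hG : G.IsOrbifoldGroupoid) {K : Set G₀} (hK : IsCompact K) (x : G₀) :
    Finset G₁ := (hG.finite_fiber hK x).toFinset

theorem IsOrbifoldGroupoid.mem_fiber (hG : G.IsOrbifoldGroupoid) {K : Set G₀} (hK : IsCompact K)
    {x : G₀} {g : G₁} : g ∈ hG.fiber hK x ↔ G.src g = x ∧ G.tgt g ∈ K :=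
  (hG.finite_fiber hK x).mem_toFinset

/-- Right multiplication by `k` is a bijection between the two fibres because it preserves targets.
This reindexing is the source of all invariance of averages. -/
theorem IsOrbifoldGroupoid.sum_fiber_mul (hG : G.IsOrbifoldGroupoid) {K : Set G₀} (hK : IsCompact K)
    (k : G₁) {A : Type*} [AddCommMonoid A] (f : G₁ → A) :
    ∑ g ∈ hG.fiber hK (G.src k), f g = ∑ g ∈ hG.fiber hK (G.tgt k), f (G.mul g k) := by
  have hb := bijOn_mul_right (G := G) k
  refine (Finset.sum_bij (fun g _ => G.mul g k) (fun g hg => ?_) (fun g hg g' hg' h => ?_)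
    (fun g hg => ?_) fun _ _ => rfl).symm
  · rw [hG.mem_fiber] at hg ⊢
    exact ⟨G.src_mul _ _ hg.1, by rw [G.tgt_mul _ _ hg.1]; exact hg.2⟩
  · rw [hG.mem_fiber] at hg hg'
    exact hb.injOn hg.1 hg'.1 h
  · rw [hG.mem_fiber] at hg
    obtain ⟨a, ha, hag⟩ := hb.surjOn hg.1
    refine ⟨a, ?_, hag⟩
    rw [hG.mem_fiber]
    refine ⟨ha, ?_⟩
    rw [← G.tgt_mul a k ha]
    change G.mul a k = g at hag
    rw [hag]
    exact hg.2

/-- Sums over the arrows from a variable point to a compact set are locally sums over finitely many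
local sections of the source map. -/
theorem IsOrbifoldGroupoid.exists_sum_fiber_eq (hG : G.IsOrbifoldGroupoid) {K : Set G₀}
    (hK : IsCompact K) (y₀ : G₀) :
    ∃ (T : Finset G₁) (σ : G₁ → G₀ → G₁),
      (∀ g ∈ T, G.tgt (σ g y₀) ∈ K ∧ (∀ᶠ y in 𝓝 y₀, G.src (σ g y) = y) ∧
        ∀ᶠ y in 𝓝 y₀, ContMDiffAt 𝓘(ℝ, B₀) 𝓘(ℝ, B₁) ∞ (σ g) y) ∧
      ∀ {A : G₀ → Type _} [∀ y, AddCommMonoid (A y)] (f : ∀ y, G₁ → A y),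
        (∀ y g, G.tgt g ∉ K → f y g = 0) →
        ∀ᶠ y in 𝓝 y₀, ∑ g ∈ hG.fiber hK y, f y g = ∑ g ∈ T, f y (σ g y) := by
  classical
  obtain ⟨T, σ, h1, h2⟩ := hG.exists_local_sections hK y₀
  refine ⟨T, σ, fun g hg => ?_, fun f hf => ?_⟩
  · obtain ⟨a, b, c⟩ := h1 g hg
    exact ⟨b.symm ▸ a, c⟩
  · have h3 : ∀ᶠ y in 𝓝 y₀, ∀ g ∈ T, G.src (σ g y) = y :=
      (eventually_all_finset _).2 fun g hg => (h1 g hg).2.2.1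
    filter_upwards [h2, h3] with y hy hy'
    rw [← Finset.sum_image (f := f y) (g := fun g => σ g y) hy.1]
    -- For `y ≠ y₀` a value `σ g y` may have its target outside `K`; such extra terms vanish by
    -- `hf`.
    refine Finset.sum_subset (fun h hh => ?_) fun h hh hh' => hf y h fun hK' => hh' ?_
    · rw [hG.mem_fiber] at hh
      obtain ⟨g, hg, rfl⟩ := hy.2 h hh.1 hh.2
      exact Finset.mem_image_of_mem _ hg
    · rw [hG.mem_fiber]
      obtain ⟨g, hg, rfl⟩ := Finset.mem_image.1 hh
      exact ⟨hy' g hg, hK'⟩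

end LieGroupoid

/-! ### Pullback of a trivial connection along an arrow -/

namespace VectorGBundle

variable {B₀ B₁ : Type*} [NormedAddCommGroup B₀] [NormedSpace ℝ B₀]
  [NormedAddCommGroup B₁] [NormedSpace ℝ B₁]
  {G₀ G₁ : Type*} [TopologicalSpace G₀] [ChartedSpace B₀ G₀]
  [TopologicalSpace G₁] [ChartedSpace B₁ G₁]
  {G : LieGroupoid B₀ B₁ G₀ G₁}
  {F : Type*} [NormedAddCommGroup F] [NormedSpace ℝ F]
  {V : G₀ → Type*} [TopologicalSpace (TotalSpace F V)]
  [∀ x, AddCommGroup (V x)] [∀ x, Module ℝ (V x)] [∀ x, TopologicalSpace (V x)]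
  [FiberBundle F V] [VectorBundle ℝ F V] [ContMDiffVectorBundle ∞ F V 𝓘(ℝ, B₀)]
  (E : VectorGBundle G F V)

variable (e : Trivialization F (TotalSpace.proj : TotalSpace F V → G₀))

variable {e} in
theorem act_invHom_symmₗ_transportCoord [MemTrivializationAtlas e] (ξ : ∀ x, V x) {x y : G₀}
    (g : G.Hom x y) (hy : y ∈ e.baseSet) :
    E.act (G.invHom g) (e.symmₗ ℝ y (E.transportCoord e ξ g.1)) = ξ x := by
  rw [e.coe_symmₗ hy, E.transportCoord_hom, e.symm_apply_apply_mk hy, act_invHom_act]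

variable [∀ x, IsTopologicalAddGroup (V x)] [∀ x, ContinuousSMul ℝ (V x)]

section Term

variable [FiniteDimensional ℝ F] [MemTrivializationAtlas e] (b : G₀ → ℝ)

/-- The transport by the inverse of an arrow `g` of a linear map with values in the model fibre,
which is identified with the fibre at the target of `g` by a local trivialization. -/
def pullbackHom {x y : G₀} (g : G.Hom x y) (L : B₀ →L[ℝ] F) : TangentSpace 𝓘(ℝ, B₀) x →L[ℝ] V x :=
  (LinearMap.toContinuousLinearMap (E.act (G.invHom g) ∘ₗ e.symmₗ ℝ y)).comp L

/-- The pullback along an arrow `g` that starts at `x` of the trivial connection given by a local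
trivialization at the target of `g`, multiplied by the value of `b` at the target. -/
def pullbackTerm (ξ : ∀ x, V x) (x : G₀) (g : G₁) : TangentSpace 𝓘(ℝ, B₀) x →L[ℝ] V x :=
  open Classical in
  -- The alternative `0` only makes the term total in `g`; the sums below run over arrows with
  -- source `x`.
  if h : G.src g = x then
    b (G.tgt g) • E.pullbackHom e (G.homOfSrc h) (E.transportDeriv e ξ g)
  else 0

variable {e b}

theorem pullbackTerm_apply (ξ : ∀ x, V x) {x y : G₀} (g : G.Hom x y)
    (v : TangentSpace 𝓘(ℝ, B₀) x) :
    E.pullbackTerm e b ξ x g.1 v =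
      b y • E.act (G.invHom g) (e.symmₗ ℝ y (E.transportDeriv e ξ g.1 v)) := by
  obtain ⟨g, rfl, rfl⟩ := g
  have h : E.pullbackTerm e b ξ (G.src g) g =
      b (G.tgt g) • E.pullbackHom e (G.arrow g) (E.transportDeriv e ξ g) := dif_pos rfl
  exact congrArg (fun L : TangentSpace 𝓘(ℝ, B₀) (G.src g) →L[ℝ] V (G.src g) => L v) h

theorem pullbackTerm_eq_zero {ξ : ∀ x, V x} {x : G₀} {g : G₁} (hb : b (G.tgt g) = 0) :
    E.pullbackTerm e b ξ x g = 0 := by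
  unfold pullbackTerm
  split_ifs
  · rw [hb, zero_smul]
  · rfl

/-- The Leibniz rule of `transportDeriv_smul` is carried back to `x` by the inverse of `g`, which
turns the transported coordinates of `ξ` back into `ξ x`. Where `b` vanishes both sides are zero, so
the target may be assumed to lie in the base set. -/
theorem pullbackTerm_smul (hG : G.IsEtale) (hb : ∀ y, b y ≠ 0 → y ∈ e.baseSet)
    (φ : C^∞⟮𝓘(ℝ, B₀), G₀; ℝ⟯) (ξ : Cₛ^∞⟮𝓘(ℝ, B₀); F, V⟯) {x : G₀} {g : G₁} (hg : G.src g = x)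
    (v : TangentSpace 𝓘(ℝ, B₀) x) :
    E.pullbackTerm e b ⇑(φ • ξ) x g v = b (G.tgt g) • (mvfderiv 𝓘(ℝ, B₀) φ x v • ξ x) +
      φ x • E.pullbackTerm e b ξ x g v := by
  by_cases h0 : b (G.tgt g) = 0
  · simp [E.pullbackTerm_eq_zero h0, h0]
  have hy := hb _ h0
  subst hg
  have h1 := E.transportDeriv_smul hG φ ξ hy v
  have h2 := E.pullbackTerm_apply (e := e) (b := b) ⇑(φ • ξ) (G.arrow g) v
  have h3 := E.pullbackTerm_apply (e := e) (b := b) ξ (G.arrow g) v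
  have h4 := E.act_invHom_symmₗ_transportCoord (e := e) ξ (G.arrow g) hy
  change E.pullbackTerm e b ⇑(φ • ξ) (G.src g) g v = b (G.tgt g) • E.act (G.invHom (G.arrow g))
    (e.symmₗ ℝ (G.tgt g) (E.transportDeriv e ⇑(φ • ξ) g v)) at h2
  change E.pullbackTerm e b ξ (G.src g) g v = b (G.tgt g) • E.act (G.invHom (G.arrow g))
    (e.symmₗ ℝ (G.tgt g) (E.transportDeriv e ξ g v)) at h3
  rw [h2, h3, h1, map_add, map_smul, map_smul, map_add, map_smul, map_smul, ← h4, smul_add, smul_comm (φ (G.src g))]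
  rfl

theorem pullbackTerm_add (hb : ∀ y, b y ≠ 0 → y ∈ e.baseSet)
    (ξ η : Cₛ^∞⟮𝓘(ℝ, B₀); F, V⟯) (x : G₀) (g : G₁) :
    E.pullbackTerm e b ⇑(ξ + η) x g = E.pullbackTerm e b ξ x g + E.pullbackTerm e b η x g := by
  by_cases h0 : b (G.tgt g) = 0
  · simp [E.pullbackTerm_eq_zero h0]
  unfold pullbackTerm
  split_ifs
  · rw [E.transportDeriv_add ξ η (hb _ h0), ← smul_add]
    congr 1
    exact ContinuousLinearMap.comp_add _ _ _
  · exact (add_zero _).symm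

/-- The arrows `g` and `g ∘ k` have the same target, hence the same weight and trivialization; the
derivatives agree by `transportDeriv_mul`, and `k ∘ (g ∘ k)⁻¹ = g⁻¹`. -/
theorem pullbackTerm_mul (hG : G.IsEtale) (hb : ∀ y, b y ≠ 0 → y ∈ e.baseSet)
    {ξ η : Cₛ^∞⟮𝓘(ℝ, B₀); F, V⟯} {k g : G₁}
    (h : ∀ᶠ h in 𝓝 k, η (G.tgt h) = E.act (G.arrow h) (ξ (G.src h)))
    (hgk : G.src g = G.tgt k) (w : TangentSpace 𝓘(ℝ, B₁) k) :
    E.pullbackTerm e b η (G.tgt k) g (E.dtgt k w) =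
      E.act (G.arrow k) (E.pullbackTerm e b ξ (G.src k) (G.mul g k) (E.dsrc k w)) := by
  by_cases h0 : b (G.tgt g) = 0
  · have h0' : b (G.tgt (G.mul g k)) = 0 := by rwa [G.tgt_mul _ _ hgk]
    simp [E.pullbackTerm_eq_zero h0, E.pullbackTerm_eq_zero h0']
  have hy := hb _ h0
  have h1 := E.pullbackTerm_apply (e := e) (b := b) η (G.homOfSrc hgk) (E.dtgt k w)
  have h2 := E.pullbackTerm_apply (e := e) (b := b) ξ (G.comp (G.homOfSrc hgk) (G.arrow k))
    (E.dsrc k w)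
  have h3 := E.transportDeriv_mul hG h hgk hy w
  have h4 : ∀ u, E.act (G.arrow k) (E.act (G.invHom (G.comp (G.homOfSrc hgk) (G.arrow k))) u) =
      E.act (G.invHom (G.homOfSrc hgk)) u := by
    intro u
    obtain ⟨z, rfl⟩ : ∃ z, u = E.act (G.comp (G.homOfSrc hgk) (G.arrow k)) z :=
      ⟨_, (E.act_act_invHom _ u).symm⟩
    rw [act_invHom_act, E.act_comp, act_invHom_act]
  refine h1.trans (Eq.trans ?_ (congrArg (E.act (G.arrow k)) h2).symm)
  rw [map_smul, h4]
  exact congrArg (fun z => b (G.tgt g) • E.act (G.invHom (G.homOfSrc hgk)) (e.symmₗ ℝ (G.tgt g) z)) h3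

/-- Evaluated on a smooth vector field, the term is the action of the smooth family of arrows `(σ
y)⁻¹` on a vector whose coordinates are a derivative of a smooth function on `G₀`. -/
theorem contMDiffAt_pullbackTerm [IsManifold 𝓘(ℝ, B₀) ∞ G₀] [FiniteDimensional ℝ B₀] (hG : G.IsEtale)
    (hb : ContMDiff 𝓘(ℝ, B₀) 𝓘(ℝ, ℝ) ∞ b) (ξ : Cₛ^∞⟮𝓘(ℝ, B₀); F, V⟯)
    {σ : G₀ → G₁} {y₀ : G₀} (hσ : ∀ᶠ y in 𝓝 y₀, G.src (σ y) = y)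
    (hσ' : ∀ᶠ y in 𝓝 y₀, ContMDiffAt 𝓘(ℝ, B₀) 𝓘(ℝ, B₁) ∞ σ y) (hy : G.tgt (σ y₀) ∈ e.baseSet) :
    ContMDiffAt 𝓘(ℝ, B₀) (𝓘(ℝ, B₀).prod 𝓘(ℝ, B₀ →L[ℝ] F)) ∞
      (fun y => TotalSpace.mk' (B₀ →L[ℝ] F)
        (E := fun x : G₀ => TangentSpace 𝓘(ℝ, B₀) x →L[ℝ] V x) y
        (E.pullbackTerm e b ξ y (σ y))) y₀ := by
  refine contMDiffAt_hom_section_of_forall_apply fun v => ?_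
  set X : ∀ y : G₀, TangentSpace 𝓘(ℝ, B₀) y := fun y =>
    (trivializationAt B₀ (TangentSpace 𝓘(ℝ, B₀)) y₀).symm y v
  have hX : ContMDiffAt 𝓘(ℝ, B₀) (𝓘(ℝ, B₀).prod 𝓘(ℝ, B₀)) ∞
      (fun y => (⟨y, X y⟩ : TotalSpace B₀ (TangentSpace 𝓘(ℝ, B₀) : G₀ → Type _))) y₀ :=
    (trivializationAt B₀ (TangentSpace 𝓘(ℝ, B₀)) y₀).contMDiffAt_mk_symm contMDiffAt_id
      contMDiffAt_const (mem_baseSet_trivializationAt _ _ y₀)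
  have hσ0 := hσ'.self_of_nhds
  have ht : ContMDiffAt 𝓘(ℝ, B₀) 𝓘(ℝ, B₀) ∞ (fun y => G.tgt (σ y)) y₀ :=
    G.tgt.contMDiff.contMDiffAt.comp y₀ hσ0
  have hu : ContMDiffAt 𝓘(ℝ, B₀) 𝓘(ℝ, F) ∞ (fun y => b (G.tgt (σ y)) •
      mvfderiv 𝓘(ℝ, B₀) (E.transportCoord e ξ ∘ σ) y (X y)) y₀ :=
    (hb.contMDiffAt.comp y₀ ht).smul
      (((E.contMDiffAt_transportCoord ξ hy).comp y₀ hσ0).mvfderiv_apply hX)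
  refine E.contMDiffAt_act (α := fun y => G.inv (σ y)) (p := fun y => ⟨G.tgt (σ y), e.symm _ _⟩)
    (G.inv.contMDiff.contMDiffAt.comp y₀ hσ0) (e.contMDiffAt_mk_symm ht hu hy) ?_
  filter_upwards [hσ, hσ', hσ.eventually_nhds,
    ht.continuousAt.eventually_mem (e.open_baseSet.mem_nhds hy)] with y h1 h2 h3 h4
  refine ⟨G.invHom (G.homOfSrc h1), rfl, ?_⟩
  refine (E.pullbackTerm_apply (e := e) (b := b) ξ (G.homOfSrc h1) (X y)).trans ?_
  -- The weight is moved into the coordinates, so that a single smooth vector over the target is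
  -- acted upon.
  rw [← map_smul, ← map_smul, e.coe_symmₗ h4]
  refine congrArg (E.act (G.invHom (G.homOfSrc h1))) ?_
  exact congrArg (fun z => e.symm (G.tgt (σ y)) (b (G.tgt (σ y)) • z))
    (E.transportDeriv_section hG ξ h3 h2 h4 (X y))

end Term

variable [IsManifold 𝓘(ℝ, B₀) ∞ G₀]

/-- A linear operator `D : Γ(G₀, V) → Γ(G₀, Hom(TG₀, V))` that is preserved by the arrows and
satisfies the Leibniz rule `D (φ ξ) = w dφ ⊗ ξ + φ D ξ` for an invariant function `w`. -/
structure WeightedConnection where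
  weight : C^∞⟮𝓘(ℝ, B₀), G₀; ℝ⟯
  weight_invariant : ∀ g : G₁, weight (G.tgt g) = weight (G.src g)
  toFun : Cₛ^∞⟮𝓘(ℝ, B₀); F, V⟯ →ₗ[ℝ] E.BaseForms
  leibniz : ∀ (φ : C^∞⟮𝓘(ℝ, B₀), G₀; ℝ⟯) (ξ : Cₛ^∞⟮𝓘(ℝ, B₀); F, V⟯) (x : G₀)
    (v : TangentSpace 𝓘(ℝ, B₀) x),
    toFun (φ • ξ) x v = weight x • (mvfderiv 𝓘(ℝ, B₀) φ x v • ξ x) + φ x • toFun ξ x v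
  invariant : ∀ (g : G₁) (ξ η : Cₛ^∞⟮𝓘(ℝ, B₀); F, V⟯),
    (∀ᶠ h in 𝓝 g, η (G.tgt h) = E.act (G.arrow h) (ξ (G.src h))) →
    ∀ w : TangentSpace 𝓘(ℝ, B₁) g,
      toFun η (G.tgt g) (E.dtgt g w) = E.act (G.arrow g) (toFun ξ (G.src g) (E.dsrc g w))

end VectorGBundle

/-! ### Averaged connections and their locally finite sums -/

namespace VectorGBundle

variable {B₀ B₁ : Type*} [NormedAddCommGroup B₀] [NormedSpace ℝ B₀]
  [NormedAddCommGroup B₁] [NormedSpace ℝ B₁]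
  {G₀ G₁ : Type*} [TopologicalSpace G₀] [ChartedSpace B₀ G₀] [IsManifold 𝓘(ℝ, B₀) ∞ G₀]
  [TopologicalSpace G₁] [ChartedSpace B₁ G₁]
  {G : LieGroupoid B₀ B₁ G₀ G₁}
  {F : Type*} [NormedAddCommGroup F] [NormedSpace ℝ F]
  {V : G₀ → Type*} [TopologicalSpace (TotalSpace F V)]
  [∀ x, AddCommGroup (V x)] [∀ x, Module ℝ (V x)] [∀ x, TopologicalSpace (V x)]
  [∀ x, IsTopologicalAddGroup (V x)] [∀ x, ContinuousSMul ℝ (V x)]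
  [FiberBundle F V] [VectorBundle ℝ F V] [ContMDiffVectorBundle ∞ F V 𝓘(ℝ, B₀)]
  {E : VectorGBundle G F V}

/-- The sum over all arrows from a point of the pullbacks of the trivial connection given by a local
trivialization, weighted by a compactly supported function `b`. -/
def averagedConnection [T2Space G₀] [T2Space G₁] [FiniteDimensional ℝ B₀] [FiniteDimensional ℝ F]
    (E : VectorGBundle G F V) (hG : G.IsOrbifoldGroupoid)
    {e : Trivialization F (TotalSpace.proj : TotalSpace F V → G₀)} [MemTrivializationAtlas e]
    {b : G₀ → ℝ} (hb : ContMDiff 𝓘(ℝ, B₀) 𝓘(ℝ, ℝ) ∞ b) {K : Set G₀} (hK : IsCompact K)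
    (hbK : ∀ y, b y ≠ 0 → y ∈ K) (hKe : K ⊆ e.baseSet) : E.WeightedConnection where
  weight := ⟨fun x => ∑ g ∈ hG.fiber hK x, b (G.tgt g), fun y₀ => by
    obtain ⟨T, σ, h1, h2⟩ := hG.exists_sum_fiber_eq hK y₀
    have h3 : ContMDiffAt 𝓘(ℝ, B₀) 𝓘(ℝ, ℝ) ∞ (fun y => ∑ g ∈ T, b (G.tgt (σ g y))) y₀ :=
      ContMDiffAt.sum fun g hg => hb.contMDiffAt.comp y₀
        (G.tgt.contMDiff.contMDiffAt.comp y₀ (h1 g hg).2.2.self_of_nhds)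
    exact h3.congr_of_eventuallyEq (h2 (fun _ g => b (G.tgt g)) fun y g hg => by
      by_contra h
      exact hg (hbK _ h))⟩
  weight_invariant k := by
    change ∑ g ∈ hG.fiber hK (G.tgt k), b (G.tgt g) = ∑ g ∈ hG.fiber hK (G.src k), b (G.tgt g)
    rw [hG.sum_fiber_mul hK k]
    refine Finset.sum_congr rfl fun g hg => ?_
    rw [G.tgt_mul _ _ ((hG.mem_fiber hK).1 hg).1]
  toFun :=
    { toFun := fun ξ => ⟨fun x => ∑ g ∈ hG.fiber hK x, E.pullbackTerm e b ξ x g, fun y₀ => by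
        obtain ⟨T, σ, h1, h2⟩ := hG.exists_sum_fiber_eq hK y₀
        have h3 := ContMDiffAt.sum_section (s := T) fun g hg =>
          E.contMDiffAt_pullbackTerm hG.isEtale hb ξ (h1 g hg).2.1 (h1 g hg).2.2
            (hKe (h1 g hg).1)
        refine h3.congr_of_eventuallyEq ?_
        filter_upwards [h2 (fun y g => E.pullbackTerm e b ξ y g) fun y g hg =>
          E.pullbackTerm_eq_zero (by by_contra h; exact hg (hbK _ h))] with y hy
        exact congrArg (TotalSpace.mk' (B₀ →L[ℝ] F)
          (E := fun x : G₀ => TangentSpace 𝓘(ℝ, B₀) x →L[ℝ] V x) y) hy⟩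
      map_add' := fun ξ η => by
        ext1 x
        change ∑ g ∈ hG.fiber hK x, E.pullbackTerm e b ⇑(ξ + η) x g =
          ∑ g ∈ hG.fiber hK x, E.pullbackTerm e b ξ x g +
            ∑ g ∈ hG.fiber hK x, E.pullbackTerm e b η x g
        rw [← Finset.sum_add_distrib]
        exact Finset.sum_congr rfl fun g _ => E.pullbackTerm_add (fun y hy => hKe (hbK y hy)) ξ η x g
      map_smul' := fun c ξ => by
        ext1 x
        change ∑ g ∈ hG.fiber hK x, E.pullbackTerm e b ⇑(c • ξ) x g =
          c • ∑ g ∈ hG.fiber hK x, E.pullbackTerm e b ξ x g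
        rw [Finset.smul_sum]
        refine Finset.sum_congr rfl fun g hg => ?_
        ext v
        -- Homogeneity over `ℝ` is the Leibniz rule for a constant function, whose differential
        -- vanishes.
        have h := E.pullbackTerm_smul hG.isEtale (fun y hy => hKe (hbK y hy))
          (ContMDiffMap.const c : C^∞⟮𝓘(ℝ, B₀), G₀; ℝ⟯) ξ ((hG.mem_fiber hK).1 hg).1 v
        have h0 : mvfderiv 𝓘(ℝ, B₀) (ContMDiffMap.const c : C^∞⟮𝓘(ℝ, B₀), G₀; ℝ⟯) x = 0 :=
          mvfderiv_const c
        rw [h0, zero_apply, zero_smul, smul_zero, zero_add] at h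
        exact h }
  leibniz φ ξ x v := by
    change (∑ g ∈ hG.fiber hK x, E.pullbackTerm e b ⇑(φ • ξ) x g) v =
      (∑ g ∈ hG.fiber hK x, b (G.tgt g)) • _ + φ x • (∑ g ∈ hG.fiber hK x, E.pullbackTerm e b ξ x g) v
    rw [sum_apply, sum_apply, Finset.sum_smul,
      Finset.smul_sum, ← Finset.sum_add_distrib]
    exact Finset.sum_congr rfl fun g hg => E.pullbackTerm_smul hG.isEtale
      (fun y hy => hKe (hbK y hy)) φ ξ ((hG.mem_fiber hK).1 hg).1 v
  invariant k ξ η h w := by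
    change (∑ g ∈ hG.fiber hK (G.tgt k), E.pullbackTerm e b η (G.tgt k) g) (E.dtgt k w) =
      E.act (G.arrow k) ((∑ g ∈ hG.fiber hK (G.src k), E.pullbackTerm e b ξ (G.src k) g) (E.dsrc k w))
    rw [hG.sum_fiber_mul hK k, sum_apply, sum_apply, map_sum]
    exact Finset.sum_congr rfl fun g hg => E.pullbackTerm_mul hG.isEtale
      (fun y hy => hKe (hbK y hy)) h ((hG.mem_fiber hK).1 hg).1 w

theorem _root_.finsum_eq_sum_of_forall_notMem {ι A X : Type*} [AddCommMonoid A] {S : ι → Set X}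
    {N : Finset ι} {x : X} (hN : ∀ i, x ∈ S i → i ∈ N) {f : ι → A} (hf : ∀ i, x ∉ S i → f i = 0) :
    ∑ᶠ i, f i = ∑ i ∈ N, f i :=
  finsum_eq_sum_of_support_subset _ fun i hi => hN i (by by_contra h; exact hi (hf i h))

/-- A locally finite sum of weighted connections, divided by the sum of the weights, is an invariant
connection. -/
theorem exists_invariantConnection_of_locallyFinite {ι : Type*} (D : ι → E.WeightedConnection)
    {S : ι → Set G₀} (hS : LocallyFinite S) (hw : ∀ i x, x ∉ S i → (D i).weight x = 0)
    (hD : ∀ i ξ x, x ∉ S i → (D i).toFun ξ x = 0) (hne : ∀ x, ∑ᶠ i, (D i).weight x ≠ 0) :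
    Nonempty E.InvariantConnection := by
  classical
  let N : G₀ → Finset ι := fun x => (hS.point_finite x).toFinset
  have hN : ∀ x i, x ∈ S i → i ∈ N x := fun x i hi => (hS.point_finite x).mem_toFinset.2 hi
  have hsw : ∀ x, ∑ᶠ i, (D i).weight x = ∑ i ∈ N x, (D i).weight x := fun x =>
    finsum_eq_sum_of_forall_notMem (hN x) fun i hi => hw i x hi
  have hsD : ∀ ξ x, ∑ᶠ i, (D i).toFun ξ x = ∑ i ∈ N x, (D i).toFun ξ x := fun ξ x =>
    finsum_eq_sum_of_forall_notMem (hN x) fun i hi => hD i ξ x hi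
  have hcw : ContMDiff 𝓘(ℝ, B₀) 𝓘(ℝ, ℝ) ∞ fun x => ∑ᶠ i, (D i).weight x :=
    contMDiff_finsum (fun i => (D i).weight.contMDiff) (hS.subset fun i x hx => by
      by_contra h
      exact hx (hw i x h))
  have hcD : ∀ ξ, ContMDiff 𝓘(ℝ, B₀) (𝓘(ℝ, B₀).prod 𝓘(ℝ, B₀ →L[ℝ] F)) ∞
      (fun x => TotalSpace.mk' (B₀ →L[ℝ] F)
        (E := fun x : G₀ => TangentSpace 𝓘(ℝ, B₀) x →L[ℝ] V x) x (∑ᶠ i, (D i).toFun ξ x)) :=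
    fun ξ => ContMDiff.finsum_section_of_locallyFinite (t := fun i x => (D i).toFun ξ x)
      (hS.subset fun i x hx => by
        by_contra h
        exact hx (hD i ξ x h)) fun i => ((D i).toFun ξ).contMDiff
  -- Dividing by the total weight normalizes the coefficient of `dφ` in the Leibniz rule to `1`.
  let Q : Cₛ^∞⟮𝓘(ℝ, B₀); F, V⟯ → E.BaseForms := fun ξ =>
    ⟨fun x => (∑ᶠ i, (D i).weight x)⁻¹ • ∑ᶠ i, (D i).toFun ξ x,
      ContMDiff.smul_section (hcw.inv₀ hne) (hcD ξ)⟩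
  have hQ : ∀ ξ x, Q ξ x = (∑ i ∈ N x, (D i).weight x)⁻¹ • ∑ i ∈ N x, (D i).toFun ξ x := by
    intro ξ x
    rw [← hsw, ← hsD]
    rfl
  refine ⟨⟨⟨⟨Q, fun ξ η => ?_⟩, fun c ξ => ?_⟩, fun φ ξ x v => ?_, fun k ξ η h w => ?_⟩⟩
  · ext1 x
    have h : ∑ i ∈ N x, (D i).toFun (ξ + η) x =
        ∑ i ∈ N x, (D i).toFun ξ x + ∑ i ∈ N x, (D i).toFun η x := by
      rw [← Finset.sum_add_distrib]
      refine Finset.sum_congr rfl fun i _ => ?_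
      rw [map_add]
      rfl
    rw [ContMDiffSection.coe_add, Pi.add_apply, hQ, hQ, hQ, h, smul_add]
  · ext1 x
    have h : ∑ i ∈ N x, (D i).toFun (c • ξ) x = c • ∑ i ∈ N x, (D i).toFun ξ x := by
      rw [Finset.smul_sum]
      refine Finset.sum_congr rfl fun i _ => ?_
      rw [map_smul]
      rfl
    rw [RingHom.id_apply, ContMDiffSection.coe_smul, Pi.smul_apply, hQ, hQ, smul_comm c, h]
  · change Q (φ • ξ) x v = mvfderiv 𝓘(ℝ, B₀) φ x v • ξ x + φ x • Q ξ x v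
    rw [hQ, hQ, smul_apply, smul_apply,
      sum_apply, sum_apply,
      Finset.sum_congr rfl fun i _ => (D i).leibniz φ ξ x v, Finset.sum_add_distrib,
      ← Finset.sum_smul, ← Finset.smul_sum, smul_add, smul_smul, inv_mul_cancel₀, one_smul,
      smul_comm (φ x)]
    rw [← hsw]
    exact hne x
  · change Q η (G.tgt k) (E.dtgt k w) = E.act (G.arrow k) (Q ξ (G.src k) (E.dsrc k w))
    -- The sets `S i` are not assumed invariant, so a finite index set serving both ends of `k` is
    -- needed to compare the sums termwise.
    have hs : ∀ i, G.src k ∈ S i → i ∈ N (G.src k) ∪ N (G.tgt k) := fun i hi =>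
      Finset.mem_union_left _ (hN _ i hi)
    have ht : ∀ i, G.tgt k ∈ S i → i ∈ N (G.src k) ∪ N (G.tgt k) := fun i hi =>
      Finset.mem_union_right _ (hN _ i hi)
    have h1 : Q η (G.tgt k) = (∑ᶠ i, (D i).weight (G.tgt k))⁻¹ •
        ∑ i ∈ N (G.src k) ∪ N (G.tgt k), (D i).toFun η (G.tgt k) :=
      congrArg (fun z => (∑ᶠ i, (D i).weight (G.tgt k))⁻¹ • z)
        (finsum_eq_sum_of_forall_notMem ht fun i hi => hD i η _ hi)
    have h2 : Q ξ (G.src k) = (∑ᶠ i, (D i).weight (G.src k))⁻¹ •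
        ∑ i ∈ N (G.src k) ∪ N (G.tgt k), (D i).toFun ξ (G.src k) :=
      congrArg (fun z => (∑ᶠ i, (D i).weight (G.src k))⁻¹ • z)
        (finsum_eq_sum_of_forall_notMem hs fun i hi => hD i ξ _ hi)
    rw [h1, h2, smul_apply, smul_apply,
      sum_apply, sum_apply, map_smul, map_sum,
      finsum_congr fun i => (D i).weight_invariant k,
      Finset.sum_congr rfl fun i _ => (D i).invariant k ξ η h w]

end VectorGBundle

/-- Over a paracompact Hausdorff space `X` that is the image of a manifold `M` under an open map `q`,
there are bump functions on `M` with small supports, whose images in `X` are locally finite and whose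
interiors cover `X`. -/
theorem exists_locallyFinite_bumpFunctions.{u} {B : Type*} [NormedAddCommGroup B] [NormedSpace ℝ B]
    [FiniteDimensional ℝ B] {M : Type u} [TopologicalSpace M] [T2Space M] [ChartedSpace B M]
    {X : Type*} [TopologicalSpace X] [T2Space X] [ParacompactSpace X] {q : M → X}
    (hq : Continuous q) (hq' : IsOpenMap q) (hqs : Function.Surjective q) {O : M → Set M}
    (hO : ∀ y, O y ∈ 𝓝 y) :
    ∃ (ι : Type u) (c : ι → M) (ψ : ∀ i, SmoothBumpFunction 𝓘(ℝ, B) (c i)) (W : ι → Set X),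
      LocallyFinite W ∧ (∀ i, tsupport (ψ i) ⊆ O (c i) ∩ q ⁻¹' W i) ∧
        ∀ x, ∃ i y, q y = x ∧ ψ i y ≠ 0 := by
  classical
  have : LocallyCompactSpace M := Manifold.locallyCompact_of_finiteDimensional 𝓘(ℝ, B)
  choose K hK hKn using fun z : M => exists_compact_mem_nhds z
  -- Refining a cover by images of compact sets makes the closures of the shrunken sets `v z` below
  -- compact, so finitely many bump functions suffice for each `z` and local finiteness survives.
  obtain ⟨W, hWo, hWc, hWf, hWK⟩ := precise_refinement (fun z => q '' interior (K z))
    (fun z => hq' _ isOpen_interior) (Set.eq_univ_of_forall fun x => by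
      obtain ⟨z, rfl⟩ := hqs x
      exact Set.mem_iUnion.2 ⟨z, Set.mem_image_of_mem _ (mem_interior_iff_mem_nhds.2 (hKn z))⟩)
  obtain ⟨v, hvc, -, hvW⟩ := exists_iUnion_eq_closure_subset hWo (fun x => hWf.point_finite x) hWc
  have hC : ∀ z, IsCompact (closure (v z)) := fun z =>
    ((hK z).image hq).of_isClosed_subset isClosed_closure
      ((hvW z).trans ((hWK z).trans (Set.image_mono interior_subset)))
  have hψ : ∀ (z : M) (y : q ⁻¹' W z), ∃ ψ : SmoothBumpFunction 𝓘(ℝ, B) y.1,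
      tsupport ψ ⊆ O y.1 ∩ q ⁻¹' W z := fun z y => by
    obtain ⟨ψ, -, h⟩ := (SmoothBumpFunction.nhds_basis_tsupport (I := 𝓘(ℝ, B)) y.1).mem_iff.1
      (inter_mem (hO y) (((hWo z).preimage hq).mem_nhds y.2))
    exact ⟨ψ, h⟩
  choose ψ hψ using hψ
  have hT : ∀ z, ∃ T : Finset (q ⁻¹' W z), closure (v z) ⊆ ⋃ y ∈ T, q '' Function.support (ψ z y) :=
    fun z => by
      -- The images of the open supports are open because `q` is open, and every point of `closure
      -- (v z)` lifts to the centre of a bump function.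
      refine (hC z).elim_finite_subcover _ (fun y => hq' _ (ψ z y).isOpen_support) fun x hx => ?_
      obtain ⟨y, rfl⟩ := hqs x
      exact Set.mem_iUnion.2 ⟨⟨y, hvW z hx⟩, y, (ψ z ⟨y, hvW z hx⟩).c_mem_support, rfl⟩
  choose T hT using hT
  refine ⟨Σ z, T z, fun i => i.2.1.1, fun i => ψ i.1 i.2.1, fun i => W i.1, fun x => ?_,
    fun i => hψ i.1 i.2.1, fun x => ?_⟩
  · obtain ⟨t, ht, ht'⟩ := hWf x
    refine ⟨t, ht, ht'.preimage' (f := Sigma.fst) fun z _ => ?_⟩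
    refine (Set.finite_range fun y : T z => (⟨z, y⟩ : Σ z, T z)).subset ?_
    rintro ⟨z', y⟩ rfl
    exact ⟨y, rfl⟩
  · obtain ⟨z, hz⟩ := Set.mem_iUnion.1 (hvc.ge (Set.mem_univ x))
    obtain ⟨y, hy, y', hy', rfl⟩ := Set.mem_iUnion₂.1 (hT z (subset_closure hz))
    exact ⟨⟨z, y, hy⟩, y', rfl, hy'⟩

/-! ### Existence of an invariant connection -/

namespace VectorGBundle

variable {B₀ B₁ : Type*} [NormedAddCommGroup B₀] [NormedSpace ℝ B₀] [FiniteDimensional ℝ B₀]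
  [NormedAddCommGroup B₁] [NormedSpace ℝ B₁]
  {G₀ G₁ : Type*} [TopologicalSpace G₀] [T2Space G₀] [ChartedSpace B₀ G₀] [IsManifold 𝓘(ℝ, B₀) ∞ G₀]
  [TopologicalSpace G₁] [T2Space G₁] [ChartedSpace B₁ G₁]
  {G : LieGroupoid B₀ B₁ G₀ G₁}
  {F : Type*} [NormedAddCommGroup F] [NormedSpace ℝ F] [FiniteDimensional ℝ F]
  {V : G₀ → Type*} [TopologicalSpace (TotalSpace F V)]
  [∀ x, AddCommGroup (V x)] [∀ x, Module ℝ (V x)] [∀ x, TopologicalSpace (V x)]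
  [∀ x, IsTopologicalAddGroup (V x)] [∀ x, ContinuousSMul ℝ (V x)]
  [FiberBundle F V] [VectorBundle ℝ F V] [ContMDiffVectorBundle ∞ F V 𝓘(ℝ, B₀)]

/-- A vector bundle over an orbifold groupoid with paracompact Hausdorff orbit space has an
invariant connection. -/
theorem nonempty_invariantConnection (E : VectorGBundle G F V) (hG : G.IsOrbifoldGroupoid)
    {X : Type*} [TopologicalSpace X] [T2Space X] [ParacompactSpace X] (p : G.OrbitSpace ≃ₜ X) :
    Nonempty E.InvariantConnection := by
  have hq : Continuous fun x => p (G.orbitMap x) := p.continuous.comp LieGroupoid.continuous_orbitMap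
  obtain ⟨ι, c, ψ, W, hW, hψ, hc⟩ := exists_locallyFinite_bumpFunctions (B := B₀) hq
    (p.isOpenMap.comp hG.isEtale.isOpenMap_orbitMap)
    (p.surjective.comp LieGroupoid.orbitMap_surjective)
    (O := fun y => (trivializationAt F V y).baseSet) fun y =>
      (trivializationAt F V y).open_baseSet.mem_nhds (mem_baseSet_trivializationAt F V y)
  let D : ι → E.WeightedConnection := fun i =>
    E.averagedConnection hG (e := trivializationAt F V (c i)) (ψ i).contMDiff
      (ψ i).hasCompactSupport (fun y hy => subset_tsupport _ hy)
      fun y hy => (hψ i hy).1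
  -- Arrows stay within an orbit, so no arrow from a point whose orbit is outside `W i` ends in the
  -- support of `ψ i`.
  have hS : ∀ i x, x ∉ (fun x => p (G.orbitMap x)) ⁻¹' W i →
      hG.fiber (ψ i).hasCompactSupport x = ∅ := fun i x hx => by
    refine Finset.eq_empty_of_forall_notMem fun g hg => hx ?_
    obtain ⟨rfl, hg'⟩ := (hG.mem_fiber (ψ i).hasCompactSupport).1 hg
    have h := (hψ i hg').2
    rw [Set.mem_preimage, LieGroupoid.orbitMap_tgt] at h
    exact h
  have hD : ∀ i x, (D i).weight x = ∑ g ∈ hG.fiber (ψ i).hasCompactSupport x, ψ i (G.tgt g) :=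
    fun _ _ => rfl
  have hW' := hW.preimage_continuous hq
  have hw : ∀ i x, x ∉ (fun x => p (G.orbitMap x)) ⁻¹' W i → (D i).weight x = 0 := fun i x hx => by
    rw [hD, hS i x hx, Finset.sum_empty]
  refine exists_invariantConnection_of_locallyFinite D hW' hw (fun i ξ x hx => ?_)
    fun x => ?_
  · change ∑ g ∈ hG.fiber (ψ i).hasCompactSupport x, E.pullbackTerm _ _ ξ x g = 0
    rw [hS i x hx, Finset.sum_empty]
  · have h0 : ∀ i, 0 ≤ (D i).weight x := fun i => by
      rw [hD]
      exact Finset.sum_nonneg fun g _ => (ψ i).nonneg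
    -- Some bump function is nonzero at a point `y` of the orbit of `x`; an arrow from `x` to `y`
    -- contributes a positive term to a sum of nonnegative ones.
    obtain ⟨i, y, hy, hy'⟩ := hc (p (G.orbitMap x))
    obtain ⟨g⟩ := LieGroupoid.orbitMap_eq_iff.1 (p.injective hy).symm
    refine (finsum_pos h0 ⟨i, ?_⟩ ?_).ne'
    · rw [hD]
      have hgy : G.tgt g.1 = y := g.2.2
      refine Finset.sum_pos' (fun g _ => (ψ i).nonneg) ⟨g.1, (hG.mem_fiber _).2
        ⟨g.2.1, subset_tsupport _ (by rw [hgy]; exact hy')⟩, ?_⟩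
      · rw [hgy]
        exact (ψ i).nonneg.lt_of_ne' hy'
    · exact (hW'.point_finite x).subset fun i hi => by
        by_contra h
        exact hi (hw i x h)

end VectorGBundle

/-! ### Operators linear over smooth functions are pointwise -/

section Tensorial

variable {B : Type*} [NormedAddCommGroup B] [NormedSpace ℝ B] [FiniteDimensional ℝ B]
  {M : Type*} [TopologicalSpace M] [T2Space M] [ChartedSpace B M] [IsManifold 𝓘(ℝ, B) ∞ M]
  {F : Type*} [NormedAddCommGroup F] [NormedSpace ℝ F]
  {V : M → Type*} [TopologicalSpace (TotalSpace F V)]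
  [∀ x, AddCommGroup (V x)] [∀ x, Module ℝ (V x)] [∀ x, TopologicalSpace (V x)]
  [FiberBundle F V] [VectorBundle ℝ F V] [ContMDiffVectorBundle ∞ F V 𝓘(ℝ, B)]

/-- The constant sections in a local trivialization extend, as germs, to global smooth sections. -/
theorem Bundle.Trivialization.exists_contMDiffSection_eventuallyEq_symm
    (e : Trivialization F (TotalSpace.proj : TotalSpace F V → M)) [MemTrivializationAtlas e]
    {x : M} (hx : x ∈ e.baseSet) (f : F) :
    ∃ ξ : Cₛ^∞⟮𝓘(ℝ, B); F, V⟯, ∀ᶠ y in 𝓝 x, ξ y = e.symm y f := by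
  refine exists_contMDiffSection_eventuallyEq ?_
  filter_upwards [e.open_baseSet.mem_nhds hx] with y hy
  exact e.contMDiffAt_mk_symm contMDiffAt_id contMDiffAt_const hy

/-- Every vector is a value of a global smooth section. -/
theorem exists_contMDiffSection_apply_eq {x : M} (u : V x) :
    ∃ ξ : Cₛ^∞⟮𝓘(ℝ, B); F, V⟯, ξ x = u := by
  obtain ⟨ξ, hξ⟩ := (trivializationAt F V x).exists_contMDiffSection_eventuallyEq_symm (B := B)
    (mem_baseSet_trivializationAt F V x) ((trivializationAt F V x) ⟨x, u⟩).2
  refine ⟨ξ, hξ.self_of_nhds.trans ?_⟩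
  exact (trivializationAt F V x).symm_apply_apply_mk (mem_baseSet_trivializationAt F V x) u

/-- An additive map on smooth sections that is linear over the smooth functions at a point vanishes
on the sections that vanish at this point. -/
theorem ContMDiffSection.map_eq_zero_of_apply_eq_zero [FiniteDimensional ℝ F]
    {W : Type*} [AddCommGroup W] [Module ℝ W]
    (L : Cₛ^∞⟮𝓘(ℝ, B); F, V⟯ →+ W) {x : M}
    (hL : ∀ (φ : C^∞⟮𝓘(ℝ, B), M; ℝ⟯) ξ, L (φ • ξ) = φ x • L ξ)
    {ξ : Cₛ^∞⟮𝓘(ℝ, B); F, V⟯} (hξ : ξ x = 0) : L ξ = 0 := by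
  set e := trivializationAt F V x
  have hx : x ∈ e.baseSet := mem_baseSet_trivializationAt F V x
  obtain ⟨ψ, -, hψ⟩ := (SmoothBumpFunction.nhds_basis_tsupport (I := 𝓘(ℝ, B)) x).mem_iff.1
    (e.open_baseSet.mem_nhds hx)
  let b := Module.finBasis ℝ F
  let s : Fin (Module.finrank ℝ F) → Cₛ^∞⟮𝓘(ℝ, B); F, V⟯ := fun i =>
    ⟨_, ContMDiffOn.smul_section_of_tsupport (s := fun y => e.symm y (b i)) (ψ := ψ)
      ψ.contMDiff.contMDiffOn e.open_baseSet hψ fun y hy =>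
        (e.contMDiffAt_mk_symm contMDiffAt_id contMDiffAt_const hy).contMDiffWithinAt⟩
  let u : M → F := fun y => ψ y • (e ⟨y, ξ y⟩).2
  have hu : ContMDiff 𝓘(ℝ, B) 𝓘(ℝ, F) ∞ u := contMDiff_of_tsupport fun y hy => by
    have hy : y ∈ e.baseSet := hψ (tsupport_smul_subset_left _ _ hy)
    exact ψ.contMDiff.contMDiffAt.smul
      ((e.contMDiffAt_section_iff (IB := 𝓘(ℝ, B)) hy).1 ξ.contMDiff.contMDiffAt)
  let c : Fin (Module.finrank ℝ F) → C^∞⟮𝓘(ℝ, B), M; ℝ⟯ := fun i =>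
    ⟨fun y => LinearMap.toContinuousLinearMap (b.coord i) (u y),
      (LinearMap.toContinuousLinearMap (b.coord i)).contDiff.contMDiff.comp hu⟩
  let ψ' : C^∞⟮𝓘(ℝ, B), M; ℝ⟯ := ⟨ψ, ψ.contMDiff⟩
  -- One factor `ψ` globalizes the coordinates of `ξ`, the other the local frame. The coefficients
  -- `c i` vanish at `x` with `ξ`, while multiplication by `ψ` does not affect `L` since `ψ x = 1`.
  have h1 : ψ' • ψ' • ξ = ∑ i, c i • s i := by
    ext y
    have h2 : (∑ i, c i • s i) y = ∑ i, c i y • s i y := by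
      have := congrFun (map_sum (ContMDiffSection.coeAddHom 𝓘(ℝ, B) F ∞ V) (fun i => c i • s i)
        Finset.univ) y
      rw [Finset.sum_apply] at this
      exact this
    rw [h2]
    change ψ y • ψ y • ξ y = ∑ i, b.repr (u y) i • ψ y • e.symm y (b i)
    by_cases h0 : ψ y = 0
    · simp [h0]
    have hy : y ∈ e.baseSet := hψ (subset_tsupport _ h0)
    have h3 : ∑ i, b.repr (u y) i • e.symm y (b i) = e.symmₗ ℝ y (u y) := by
      conv_rhs => rw [← b.sum_repr (u y), map_sum]
      refine Finset.sum_congr rfl fun i _ => ?_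
      rw [map_smul (e.symmₗ ℝ y), e.coe_symmₗ hy]
    simp_rw [smul_comm _ (ψ y)]
    rw [← Finset.smul_sum, h3, map_smul, e.coe_symmₗ hy, e.symm_apply_apply_mk hy]
  have h4 : L (ψ' • ψ' • ξ) = L ξ := by
    have h5 : ψ' x = 1 := ψ.eq_one
    rw [hL, hL, h5, one_smul, one_smul]
  rw [← h4, h1, map_sum]
  refine Finset.sum_eq_zero fun i _ => ?_
  have h6 : c i x = 0 := by
    change b.repr (ψ x • (e ⟨x, ξ x⟩).2) i = 0
    have h7 : (e ⟨x, 0⟩).2 = 0 :=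
      (congrFun (e.coe_linearMapAt_of_mem (R := ℝ) hx) 0).symm.trans (map_zero _)
    rw [hξ, h7, smul_zero, map_zero]
    rfl
  rw [hL, h6, zero_smul]

end Tensorial

/-! ### Transport of germs of sections -/

namespace VectorGBundle

variable {B₀ B₁ : Type*} [NormedAddCommGroup B₀] [NormedSpace ℝ B₀]
  [NormedAddCommGroup B₁] [NormedSpace ℝ B₁]
  {G₀ G₁ : Type*} [TopologicalSpace G₀] [ChartedSpace B₀ G₀] [IsManifold 𝓘(ℝ, B₀) ∞ G₀]
  [TopologicalSpace G₁] [ChartedSpace B₁ G₁]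
  {G : LieGroupoid B₀ B₁ G₀ G₁}
  {F : Type*} [NormedAddCommGroup F] [NormedSpace ℝ F]
  {V : G₀ → Type*} [TopologicalSpace (TotalSpace F V)]
  [∀ x, AddCommGroup (V x)] [∀ x, Module ℝ (V x)] [∀ x, TopologicalSpace (V x)]
  [FiberBundle F V] [VectorBundle ℝ F V] [ContMDiffVectorBundle ∞ F V 𝓘(ℝ, B₀)]

/-- Every germ of a section at the source of an arrow is transported by the arrow to the germ of a
smooth section at its target. -/
theorem exists_section_act (E : VectorGBundle G F V) [T2Space G₀] [FiniteDimensional ℝ B₀] (hG : G.IsEtale) (g : G₁) (ξ : Cₛ^∞⟮𝓘(ℝ, B₀); F, V⟯) :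
    ∃ η : Cₛ^∞⟮𝓘(ℝ, B₀); F, V⟯,
      ∀ᶠ h in 𝓝 g, η (G.tgt h) = E.act (G.arrow h) (ξ (G.src h)) := by
  classical
  obtain ⟨τ, h1, h2, h3, h4⟩ := (hG.2 g).exists_local_inverse
  -- Here `τ` is a local section of the target through `g`, so near `tgt g` the vector `s y` is the
  -- transport of `ξ` by the arrow `τ y`; the value `0` is used only away from there.
  let s : ∀ y, V y := fun y =>
    if h : G.tgt (τ y) = y then E.act (⟨τ y, rfl, h⟩ : G.Hom (G.src (τ y)) y) (ξ (G.src (τ y)))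
    else 0
  have hs : ∀ h, τ (G.tgt h) = h → s (G.tgt h) = E.act (G.arrow h) (ξ (G.src h)) := by
    intro h hh
    have h5 : G.tgt (τ (G.tgt h)) = G.tgt h := congrArg G.tgt hh
    have h6 : ∀ (k : G₁) (hk : G.tgt k = G.tgt h), k = h →
        E.act (⟨k, rfl, hk⟩ : G.Hom (G.src k) (G.tgt h)) (ξ (G.src k)) =
          E.act (G.arrow h) (ξ (G.src h)) := by
      rintro k hk rfl
      rfl
    exact (dif_pos h5).trans (h6 _ h5 hh)
  obtain ⟨η, hη⟩ := exists_contMDiffSection_eventuallyEq (B := B₀) (s := s) (x₀ := G.tgt g) (by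
    filter_upwards [h4, h2.eventually_nhds] with y hy hy'
    refine E.contMDiffAt_act (p := fun y => ⟨G.src (τ y), ξ (G.src (τ y))⟩) hy
      (ξ.contMDiff.contMDiffAt.comp y (G.src.contMDiff.contMDiffAt.comp y hy)) ?_
    filter_upwards [hy'] with z hz
    exact ⟨⟨τ z, rfl, hz⟩, rfl, dif_pos hz⟩)
  refine ⟨η, ?_⟩
  filter_upwards [G.tgt.contMDiff.continuous.continuousAt.eventually hη, h3] with h hh hh'
  exact hh.trans (hs h hh')

end VectorGBundle

/-! ### Restriction, translation and difference of connections -/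

namespace VectorGBundle

variable {B₀ B₁ : Type*} [NormedAddCommGroup B₀] [NormedSpace ℝ B₀]
  [NormedAddCommGroup B₁] [NormedSpace ℝ B₁]
  {G₀ G₁ : Type*} [TopologicalSpace G₀] [ChartedSpace B₀ G₀] [IsManifold 𝓘(ℝ, B₀) ∞ G₀]
  [TopologicalSpace G₁] [ChartedSpace B₁ G₁]
  {G : LieGroupoid B₀ B₁ G₀ G₁}
  {F : Type*} [NormedAddCommGroup F] [NormedSpace ℝ F]
  {V : G₀ → Type*} [TopologicalSpace (TotalSpace F V)]
  [∀ x, AddCommGroup (V x)] [∀ x, Module ℝ (V x)] [∀ x, TopologicalSpace (V x)]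
  [∀ x, IsTopologicalAddGroup (V x)] [∀ x, ContinuousSMul ℝ (V x)]
  [FiberBundle F V] [VectorBundle ℝ F V] [ContMDiffVectorBundle ∞ F V 𝓘(ℝ, B₀)]
  {E : VectorGBundle G F V}

section Connection

@[ext] theorem Connection.ext {D D' : E.Connection} (h : ∀ ξ, D.toFun ξ = D'.toFun ξ) : D = D' := by
  cases D
  cases D'
  congr
  exact LinearMap.ext h

@[ext] theorem InvariantConnection.ext {D D' : E.InvariantConnection}
    (h : ∀ ξ x v, D.toFun ξ x v = D'.toFun ξ x v) : D = D' := by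
  cases D
  cases D'
  congr
  ext ξ x v
  exact h ξ x v

/-- The restriction of an invariant connection to the invariant sections. -/
def InvariantConnection.restrict (D : E.InvariantConnection) : E.Connection where
  toFun :=
    { toFun := fun ξ => ⟨D.toFun ξ.1, fun g w =>
        D.invariant g ξ.1 ξ.1 (Eventually.of_forall ξ.2) w⟩
      map_add' := fun ξ η => Subtype.ext (map_add D.toFun ξ.1 η.1)
      map_smul' := fun c ξ => Subtype.ext (map_smul D.toFun c ξ.1) }
  leibniz φ ξ x v := D.leibniz φ.1 ξ.1 x v

/-- The sum of a connection and of a `C^∞(G)`-linear map. -/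
def Connection.add (D : E.Connection) (L : E.sections →ₗ[G.smoothFunctions] E.forms) :
    E.Connection where
  toFun :=
    { toFun := fun ξ => L ξ + D.toFun ξ
      map_add' := fun ξ η => by rw [map_add, map_add, add_add_add_comm]
      map_smul' := fun c ξ => by
        -- Real scalars act as constant invariant functions.
        have h : L (c • ξ) = c • L ξ := map_smul L (algebraMap ℝ G.smoothFunctions c) ξ
        rw [h, map_smul, RingHom.id_apply, smul_add] }
  leibniz φ ξ x v := by
    change (L (φ • ξ)).1 x v + (D.toFun (φ • ξ)).1 x v =
      mvfderiv 𝓘(ℝ, B₀) φ.1 x v • ξ.1 x + φ.1 x • ((L ξ).1 x v + (D.toFun ξ).1 x v)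
    have h : (L (φ • ξ)).1 x v = φ.1 x • (L ξ).1 x v := by
      rw [map_smul]
      rfl
    rw [h, D.leibniz, smul_add, add_left_comm]

/-- The difference of two connections. -/
def Connection.sub (D D' : E.Connection) : E.sections →ₗ[G.smoothFunctions] E.forms where
  toFun ξ := D.toFun ξ - D'.toFun ξ
  map_add' ξ η := by rw [map_add, map_add, add_sub_add_comm]
  map_smul' φ ξ := by
    refine Subtype.ext ?_
    ext x v
    change (D.toFun (φ • ξ)).1 x v - (D'.toFun (φ • ξ)).1 x v =
      φ.1 x • ((D.toFun ξ).1 x v - (D'.toFun ξ).1 x v)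
    rw [D.leibniz, D'.leibniz, add_sub_add_left_eq_sub, smul_sub]

/-- The connections form an affine space over the `C^∞(G)`-linear maps from the invariant sections
to the invariant `1`-forms, as soon as there is a connection. -/
@[reducible] def Connection.addTorsor [Nonempty E.Connection] :
    AddTorsor (E.sections →ₗ[G.smoothFunctions] E.forms) E.Connection where
  vadd L D := D.add L
  zero_vadd D := Connection.ext fun ξ => zero_add (D.toFun ξ)
  add_vadd L L' D := Connection.ext fun ξ => add_assoc (L ξ) (L' ξ) (D.toFun ξ)
  vsub D D' := D.sub D'
  vsub_vadd' D D' := Connection.ext fun ξ => sub_add_cancel (D.toFun ξ) (D'.toFun ξ)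
  vadd_vsub' L D := LinearMap.ext fun ξ => add_sub_cancel_right (L ξ) (D.toFun ξ)

end Connection

section EndForms

variable [FiniteDimensional ℝ B₀]

/-- The evaluation of an endomorphism-valued `1`-form on a section. -/
def BaseEndForms.apply (A : E.BaseEndForms) (ξ : Cₛ^∞⟮𝓘(ℝ, B₀); F, V⟯) : E.BaseForms :=
  -- Continuity in the tangent vector is automatic in finite dimension.
  ⟨fun x => (LinearMap.toContinuousLinearMap
      ({ toFun := fun v : B₀ => A x v (ξ x)
         map_add' := fun v v' => congrArg (fun L : V x →L[ℝ] V x => L (ξ x)) (map_add (A x) v v')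
         map_smul' := fun c v => congrArg (fun L : V x →L[ℝ] V x => L (ξ x)) (map_smul (A x) c v) } :
        B₀ →ₗ[ℝ] V x) : B₀ →L[ℝ] V x), fun x₀ => by
    refine contMDiffAt_hom_section_of_forall_apply
      (V₁ := (TangentSpace 𝓘(ℝ, B₀) : G₀ → Type _)) fun v => ?_
    have hX : ContMDiffAt 𝓘(ℝ, B₀) (𝓘(ℝ, B₀).prod 𝓘(ℝ, B₀)) ∞
        (fun y => (⟨y, (trivializationAt B₀ (TangentSpace 𝓘(ℝ, B₀)) x₀).symm y v⟩ :
          TotalSpace B₀ (TangentSpace 𝓘(ℝ, B₀) : G₀ → Type _))) x₀ :=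
      (trivializationAt B₀ (TangentSpace 𝓘(ℝ, B₀)) x₀).contMDiffAt_mk_symm contMDiffAt_id
        contMDiffAt_const (mem_baseSet_trivializationAt _ _ x₀)
    exact ((A.contMDiff x₀).clm_bundle_apply (E₁ := (TangentSpace 𝓘(ℝ, B₀) : G₀ → Type _))
      (b := fun y => y) hX).clm_bundle_apply (ξ.contMDiff x₀)⟩

/-- The sum of an invariant connection and of an invariant endomorphism-valued `1`-form. -/
def InvariantConnection.add (D : E.InvariantConnection) (A : E.endForms) :
    E.InvariantConnection where
  toFun :=
    { toFun := fun ξ => BaseEndForms.apply A.1 ξ + D.toFun ξ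
      map_add' := fun ξ η => by
        ext x v
        change A.1 x v (ξ x + η x) + D.toFun (ξ + η) x v =
          A.1 x v (ξ x) + D.toFun ξ x v + (A.1 x v (η x) + D.toFun η x v)
        rw [map_add, map_add, add_add_add_comm]
        rfl
      map_smul' := fun c ξ => by
        ext x v
        change A.1 x v (c • ξ x) + D.toFun (c • ξ) x v = c • (A.1 x v (ξ x) + D.toFun ξ x v)
        rw [map_smul, map_smul, smul_add]
        rfl }
  leibniz φ ξ x v := by
    change A.1 x v (φ x • ξ x) + D.toFun (φ • ξ) x v =
      mvfderiv 𝓘(ℝ, B₀) φ x v • ξ x + φ x • (A.1 x v (ξ x) + D.toFun ξ x v)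
    rw [map_smul, D.leibniz, smul_add, add_left_comm]
  invariant g ξ η h w := by
    change A.1 (G.tgt g) (E.dtgt g w) (η (G.tgt g)) + D.toFun η (G.tgt g) (E.dtgt g w) =
      E.act (G.arrow g) (A.1 (G.src g) (E.dsrc g w) (ξ (G.src g)) +
        D.toFun ξ (G.src g) (E.dsrc g w))
    rw [D.invariant g ξ η h w, h.self_of_nhds, A.2 g w, map_add]

/-- Every vector of a fibre is the value of a global section. This gives the uniqueness of the
difference of two invariant connections. -/
theorem endForms_ext [T2Space G₀] {A A' : E.endForms}
    (h : ∀ (ξ : Cₛ^∞⟮𝓘(ℝ, B₀); F, V⟯) x v, A.1 x v (ξ x) = A'.1 x v (ξ x)) : A = A' := by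
  refine Subtype.ext ?_
  ext x v u
  obtain ⟨ξ, rfl⟩ := exists_contMDiffSection_apply_eq (B := B₀) (F := F) u
  exact h ξ x v

end EndForms

end VectorGBundle

/-! ### Differences of invariant connections as endomorphism-valued forms -/

namespace VectorGBundle

variable {B₀ B₁ : Type*} [NormedAddCommGroup B₀] [NormedSpace ℝ B₀] [FiniteDimensional ℝ B₀]
  [NormedAddCommGroup B₁] [NormedSpace ℝ B₁]
  {G₀ G₁ : Type*} [TopologicalSpace G₀] [T2Space G₀] [ChartedSpace B₀ G₀] [IsManifold 𝓘(ℝ, B₀) ∞ G₀]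
  [TopologicalSpace G₁] [ChartedSpace B₁ G₁]
  {G : LieGroupoid B₀ B₁ G₀ G₁}
  {F : Type*} [NormedAddCommGroup F] [NormedSpace ℝ F] [FiniteDimensional ℝ F]
  {V : G₀ → Type*} [TopologicalSpace (TotalSpace F V)]
  [∀ x, AddCommGroup (V x)] [∀ x, Module ℝ (V x)] [∀ x, TopologicalSpace (V x)]
  [∀ x, IsTopologicalAddGroup (V x)] [∀ x, ContinuousSMul ℝ (V x)]
  [FiberBundle F V] [VectorBundle ℝ F V] [ContMDiffVectorBundle ∞ F V 𝓘(ℝ, B₀)]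
  {E : VectorGBundle G F V}

/-- A linear operator from sections to `1`-forms that is linear over the smooth functions is at each
point given by a linear map with values in the endomorphisms of the fibre. -/
theorem exists_clm_of_map_smul (Δ : Cₛ^∞⟮𝓘(ℝ, B₀); F, V⟯ →ₗ[ℝ] E.BaseForms)
    (hΔ : ∀ (φ : C^∞⟮𝓘(ℝ, B₀), G₀; ℝ⟯) ξ, Δ (φ • ξ) = φ • Δ ξ) (x : G₀) :
    ∃ A : TangentSpace 𝓘(ℝ, B₀) x →L[ℝ] V x →L[ℝ] V x, ∀ ξ v, A v (ξ x) = Δ ξ x v := by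
  have : FiniteDimensional ℝ (V x) := VectorBundle.finiteDimensional ℝ F V x
  have : T2Space (V x) := FiberBundle.t2Space F V x
  let ev : Cₛ^∞⟮𝓘(ℝ, B₀); F, V⟯ →ₗ[ℝ] V x :=
    { toFun := fun ξ => ξ x, map_add' := fun _ _ => rfl, map_smul' := fun _ _ => rfl }
  have hev : Function.Surjective ev := fun u => exists_contMDiffSection_apply_eq u
  -- A linear choice of global sections through the vectors of the fibre, which makes `u ↦ Δ (r u)
  -- x` linear; by tensoriality the choice does not matter.
  obtain ⟨r, hr⟩ := ev.exists_rightInverse_of_surjective (LinearMap.range_eq_top.2 hev)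
  let Δx : Cₛ^∞⟮𝓘(ℝ, B₀); F, V⟯ →+ (B₀ →L[ℝ] V x) :=
    { toFun := fun ξ => Δ ξ x
      map_zero' := by rw [map_zero]; rfl
      map_add' := fun ξ η => by rw [map_add]; rfl }
  have hr' : ∀ ξ : Cₛ^∞⟮𝓘(ℝ, B₀); F, V⟯, Δ (r (ξ x)) x = Δ ξ x := fun ξ => by
    have h1 : (r (ξ x) - ξ) x = 0 := sub_eq_zero.2 (LinearMap.congr_fun hr (ξ x))
    have h2 : Δx (r (ξ x) - ξ) = 0 := ContMDiffSection.map_eq_zero_of_apply_eq_zero Δx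
      (fun φ ξ => congrArg (fun α : E.BaseForms => α x) (hΔ φ ξ)) h1
    rw [map_sub] at h2
    exact sub_eq_zero.1 h2
  let a : B₀ →ₗ[ℝ] V x →L[ℝ] V x := LinearMap.toContinuousLinearMap.toLinearMap ∘ₗ
    LinearMap.mk₂ ℝ (fun (v : B₀) (u : V x) => Δ (r u) x v)
      (fun v v' u => map_add (Δ (r u) x) v v') (fun c v u => map_smul (Δ (r u) x) c v)
      (fun v u u' => by rw [map_add, map_add]; rfl) (fun c v u => by rw [map_smul, map_smul]; rfl)
  refine ⟨(LinearMap.toContinuousLinearMap a : B₀ →L[ℝ] V x →L[ℝ] V x), fun ξ v => ?_⟩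
  exact congrArg (fun L : B₀ →L[ℝ] V x => L v) (hr' ξ)

/-- A linear operator from sections to `1`-forms that is linear over the smooth functions and
preserved by the arrows is given by an invariant endomorphism-valued `1`-form. -/
theorem exists_endForms_of_map_smul (hG : G.IsEtale)
    (Δ : Cₛ^∞⟮𝓘(ℝ, B₀); F, V⟯ →ₗ[ℝ] E.BaseForms)
    (hΔ : ∀ (φ : C^∞⟮𝓘(ℝ, B₀), G₀; ℝ⟯) ξ, Δ (φ • ξ) = φ • Δ ξ)
    (hΔ' : ∀ (g : G₁) (ξ η : Cₛ^∞⟮𝓘(ℝ, B₀); F, V⟯),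
      (∀ᶠ h in 𝓝 g, η (G.tgt h) = E.act (G.arrow h) (ξ (G.src h))) →
      ∀ w : TangentSpace 𝓘(ℝ, B₁) g,
        Δ η (G.tgt g) (E.dtgt g w) = E.act (G.arrow g) (Δ ξ (G.src g) (E.dsrc g w))) :
    ∃ A : E.endForms, ∀ ξ x v, A.1 x v (ξ x) = Δ ξ x v := by
  choose A hA using exists_clm_of_map_smul Δ hΔ
  refine ⟨⟨⟨A, fun x₀ => ?_⟩, fun g w u => ?_⟩, fun ξ x v => hA x ξ v⟩
  · refine contMDiffAt_hom_section_of_forall_apply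
      (V₁ := (TangentSpace 𝓘(ℝ, B₀) : G₀ → Type _)) fun v => ?_
    refine contMDiffAt_hom_section_of_forall_apply fun f => ?_
    -- Near `x₀` the constant frame section `f` agrees with a global section `ξ`, on which `A` is
    -- the smooth form `Δ ξ`.
    obtain ⟨ξ, hξ⟩ := (trivializationAt F V x₀).exists_contMDiffSection_eventuallyEq_symm (B := B₀)
      (mem_baseSet_trivializationAt F V x₀) f
    have hX : ContMDiffAt 𝓘(ℝ, B₀) (𝓘(ℝ, B₀).prod 𝓘(ℝ, B₀)) ∞
        (fun y => (⟨y, (trivializationAt B₀ (TangentSpace 𝓘(ℝ, B₀)) x₀).symm y v⟩ :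
          TotalSpace B₀ (TangentSpace 𝓘(ℝ, B₀) : G₀ → Type _))) x₀ :=
      (trivializationAt B₀ (TangentSpace 𝓘(ℝ, B₀)) x₀).contMDiffAt_mk_symm contMDiffAt_id
        contMDiffAt_const (mem_baseSet_trivializationAt _ _ x₀)
    refine (((Δ ξ).contMDiff x₀).clm_bundle_apply (E₁ := (TangentSpace 𝓘(ℝ, B₀) : G₀ → Type _))
      (b := fun y => y) hX).congr_of_eventuallyEq ?_
    filter_upwards [hξ] with y hy
    rw [← hy]
    exact congrArg (TotalSpace.mk' F y) (hA y ξ _)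
  · obtain ⟨ξ, rfl⟩ := exists_contMDiffSection_apply_eq (B := B₀) (F := F) u
    -- Invariance of `Δ` compares germs, so the vector `u` is first extended to `ξ` and the germ of
    -- `ξ` is then transported along `g`.
    obtain ⟨η, hη⟩ := E.exists_section_act hG g ξ
    have h := hΔ' g ξ η hη w
    rw [← hA, ← hA, hη.self_of_nhds] at h
    exact h

/-- The terms in `dφ` cancel, so the difference is linear over `C^∞(G₀)`, and it is preserved by the
arrows because both connections are. -/
theorem InvariantConnection.exists_sub (hG : G.IsEtale) (D D' : E.InvariantConnection) :
    ∃ A : E.endForms, ∀ ξ x v, A.1 x v (ξ x) = D.toFun ξ x v - D'.toFun ξ x v := by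
  refine exists_endForms_of_map_smul hG (D.toFun - D'.toFun) (fun φ ξ => ?_) fun g ξ η h w => ?_
  · ext x v
    change D.toFun (φ • ξ) x v - D'.toFun (φ • ξ) x v =
      φ x • (D.toFun ξ x v - D'.toFun ξ x v)
    rw [D.leibniz, D'.leibniz, add_sub_add_left_eq_sub, smul_sub]
  · change D.toFun η (G.tgt g) (E.dtgt g w) - D'.toFun η (G.tgt g) (E.dtgt g w) =
      E.act (G.arrow g) (D.toFun ξ (G.src g) (E.dsrc g w) - D'.toFun ξ (G.src g) (E.dsrc g w))
    rw [D.invariant g ξ η h w, D'.invariant g ξ η h w, map_sub]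

/-- The invariant connections on a vector bundle over an étale groupoid form an affine space over the
invariant endomorphism-valued `1`-forms, as soon as there is an invariant connection. -/
@[reducible] def InvariantConnection.addTorsor [Nonempty E.InvariantConnection]
    (hG : G.IsEtale) : AddTorsor E.endForms E.InvariantConnection where
  vadd A D := D.add A
  zero_vadd D := InvariantConnection.ext fun ξ x v => zero_add (D.toFun ξ x v)
  add_vadd A A' D := InvariantConnection.ext fun ξ x v =>
    add_assoc (A.1 x v (ξ x)) (A'.1 x v (ξ x)) (D.toFun ξ x v)
  -- The choice is harmless: the form is determined by its values on sections, by `endForms_ext`.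
  vsub D D' := (D.exists_sub hG D').choose
  vsub_vadd' D D' := InvariantConnection.ext fun ξ x v =>
    (congrArg (· + D'.toFun ξ x v) ((D.exists_sub hG D').choose_spec ξ x v)).trans
      (sub_add_cancel _ _)
  vadd_vsub' A D := endForms_ext fun ξ x v =>
    (((D.add A).exists_sub hG D).choose_spec ξ x v).trans
      (add_sub_cancel_right (A.1 x v (ξ x)) (D.toFun ξ x v))

end VectorGBundle

end

theorem mainTheorem9
    {B₀ B₁ : Type*} [NormedAddCommGroup B₀] [NormedSpace ℝ B₀] [FiniteDimensional ℝ B₀]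
    [NormedAddCommGroup B₁] [NormedSpace ℝ B₁] [FiniteDimensional ℝ B₁]
    {G₀ G₁ : Type*}
    [TopologicalSpace G₀] [T2Space G₀] [ChartedSpace B₀ G₀] [IsManifold 𝓘(ℝ, B₀) ∞ G₀]
    [TopologicalSpace G₁] [T2Space G₁] [ChartedSpace B₁ G₁] [IsManifold 𝓘(ℝ, B₁) ∞ G₁]
    (G : LieGroupoid B₀ B₁ G₀ G₁) (hG : G.IsOrbifoldGroupoid)
    {X : Type*} [TopologicalSpace X] [T2Space X] [ParacompactSpace X] (p : G.OrbitSpace ≃ₜ X)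
    {F : Type*} [NormedAddCommGroup F] [NormedSpace ℝ F] [FiniteDimensional ℝ F]
    {V : G₀ → Type*} [TopologicalSpace (TotalSpace F V)]
    [∀ x, AddCommGroup (V x)] [∀ x, Module ℝ (V x)] [∀ x, TopologicalSpace (V x)]
    [∀ x, IsTopologicalAddGroup (V x)] [∀ x, ContinuousSMul ℝ (V x)]
    [FiberBundle F V] [VectorBundle ℝ F V] [ContMDiffVectorBundle ∞ F V 𝓘(ℝ, B₀)]
    (E : VectorGBundle G F V) :
    -- there is a connection on `E`
    Nonempty E.Connection ∧
    -- the connections form a nonempty affine space modelled on `Hom_{C^∞(G)}(Γ(G, E), Ω¹(G, E))`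
    (∃ _ : AddTorsor (E.sections →ₗ[G.smoothFunctions] E.forms) E.Connection,
      ∀ (L : E.sections →ₗ[G.smoothFunctions] E.forms) (D : E.Connection) (ξ : E.sections),
        (L +ᵥ D).toFun ξ = L ξ + D.toFun ξ) ∧
    -- the invariant connections form a nonempty affine space modelled on `Ω¹(G, End E)`
    (∃ _ : AddTorsor E.endForms E.InvariantConnection,
      ∀ (A : E.endForms) (D : E.InvariantConnection) (ξ : Cₛ^∞⟮𝓘(ℝ, B₀); F, V⟯)
        (x : G₀) (v : TangentSpace 𝓘(ℝ, B₀) x),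
        (A +ᵥ D).toFun ξ x v = A.1 x v (ξ x) + D.toFun ξ x v) ∧
    -- every invariant connection restricts to a connection
    (∀ D : E.InvariantConnection, ∃ D' : E.Connection,
      ∀ ξ : E.sections, (D'.toFun ξ).1 = D.toFun ξ.1) := by
  obtain ⟨D⟩ := E.nonempty_invariantConnection hG p
  have : Nonempty E.InvariantConnection := ⟨D⟩
  have : Nonempty E.Connection := ⟨D.restrict⟩
  exact ⟨this, ⟨VectorGBundle.Connection.addTorsor, fun _ _ _ => rfl⟩,
    ⟨VectorGBundle.InvariantConnection.addTorsor hG.isEtale, fun _ _ _ _ _ => rfl⟩,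
    fun D => ⟨D.restrict, fun _ => rfl⟩⟩
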